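/- All monoids are commutative, written multiplicatively and with unit $1$. An ideal of a monoid $M$ is a subset $\mathfrak m\subseteq M$ (possibly empty) with $M\mathfrak m\subseteq\mathfrak m$; a proper ideal $\mathfrak p$ is prime if $ab\in\mathfrak p$ implies $a\in\mathfrak p$ or $b\in\mathfrak p$. The set $\mathrm{Spec}(M)$ of prime ideals carries the Zariski topology, with basis $D(f)=\{\mathfrak p : f\notin\mathfrak p\}$, $f\in M$. For an $M$-set $A$, let $\widetilde A$ be the sheaf on $\mathrm{Spec}(M)$ whose sections over $U$ are the families in $\prod_{\mathfrak p\in U}A_{\mathfrak p}$ that are locally of the form $a/s$ with $a\in A$, $s\in M$; equivalently, $\Gamma(D(f),\widetilde A)=A_f$. Then $\mathcal O_M=\widetilde M$ is a sheaf of monoids and $\widetilde A$ is a sheaf of $\mathcal O_M$-sets. A monoid scheme $X$ is a topological space with a sheaf $\mathcal O_X$ of monoids that is covered by open subspaces isomorphic to affine monoid schemes $(\mathrm{Spec}(M),\mathcal O_M)$. A sheaf of $\mathcal O_X$-sets is quasi-coherent if every point of $X$ has an open affine neighbourhood $\mathrm{Spec}(M)$ on which the sheaf is isomorphic to $\widetilde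 A$ for some $M$-set $A$; $\mathfrak{Qc}(X)$ is the category of quasi-coherent sheaves and all morphisms of sheaves of $\mathcal O_X$-sets. A monoid is $s$-Noetherian if it satisfies the ascending chain condition on ideals, and a monoid scheme is $s$-Noetherian if it is covered by finitely many open affine subschemes $\mathrm{Spec}(M_i)$ with each $M_i$ an $s$-Noetherian monoid. Finally, $\Omega^M$ denotes the set of ideals of $M$, made into an $M$-set by $a\cdot\mathfrak m=(\mathfrak m:a)=\{x\in M : ax\in\mathfrak m\}$. **Theorem.** Let $X$ be an $s$-Noetherian monoid scheme. There exist a quasi-coherent sheaf $\Omega^X$ on $X$ and a morphism $t\colon 1\to\Omega^X$ from the terminal object of $\mathfrak{Qc}(X)$ such that: 1. $(\Omega^X,t)$ is a subobject classifier of $\mathfrak{Qc}(X)$; 2. for every open affine monoid subscheme $V=\mathrm{Spec}(M)$ of $X$ there is an isomorphism of sheaves of $\mathcal O_V$-sets $\Omega^X|_V\cong\widetilde{\Omega^M}$ under which $t|_V$ corresponds to the global section of $\widetilde{\Omega^M}$ given by the element $M\in\Omega^M$. -/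

import Mathlib

open CategoryTheory TopologicalSpace Opposite AlgebraicGeometry

universe u

noncomputable section

namespace MonoidGeometry

/-! ### Spectra of commutative monoids -/

/-- The prime ideals of a commutative monoid: proper ideals `𝔭` (possibly empty) such that
`a * b ∈ 𝔭` implies `a ∈ 𝔭` or `b ∈ 𝔭`. -/
@[ext]
structure MSpec (M : Type u) [CommMonoid M] where
  asIdeal : SemigroupIdeal M
  one_notMem : (1 : M) ∉ asIdeal
  mem_or_mem : ∀ a b : M, a * b ∈ asIdeal → a ∈ asIdeal ∨ b ∈ asIdeal

namespace MSpec

variable {M : Type u} [CommMonoid M]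

/-- The complement of a prime ideal, a submonoid. -/
def primeCompl (p : MSpec M) : Submonoid M where
  carrier := {a | a ∉ p.asIdeal}
  one_mem' := p.one_notMem
  mul_mem' := fun {a b} ha hb hab => (p.mem_or_mem a b hab).elim ha hb

/-- The basic set `D(f)` of the primes that do not contain `f`. -/
def basicOpen (f : M) : Set (MSpec M) := {p | f ∉ p.asIdeal}

/-- The closed set `V(𝔞)` of the primes that contain the ideal `𝔞`. -/
def zeroLocus (I : SemigroupIdeal M) : Set (MSpec M) := {p | I ≤ p.asIdeal}

/-- The Zariski topology, generated by the sets `D(f)`. -/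
instance : TopologicalSpace (MSpec M) :=
  TopologicalSpace.generateFrom (Set.range basicOpen)

/-- The sets `D(f)` form a basis of the Zariski topology. -/
theorem isTopologicalBasis_basicOpen :
    IsTopologicalBasis (Set.range (basicOpen : M → Set (MSpec M))) where
  exists_subset_inter := by
    rintro _ ⟨f, rfl⟩ _ ⟨g, rfl⟩ p ⟨hf, hg⟩
    refine ⟨_, ⟨f * g, rfl⟩, fun h => (p.mem_or_mem f g h).elim hf hg, fun q hq => ⟨?_, ?_⟩⟩
    · exact fun h => hq (by rw [mul_comm]; exact q.asIdeal.smul_mem g h)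
    · exact fun h => hq (q.asIdeal.smul_mem f h)
  sUnion_eq := Set.eq_univ_of_forall fun p => ⟨_, ⟨1, rfl⟩, p.one_notMem⟩
  eq_generateFrom := rfl

/-- The closed sets of the Zariski topology are exactly the sets `V(𝔞)`. -/
theorem isClosed_iff_zeroLocus (Z : Set (MSpec M)) :
    IsClosed Z ↔ ∃ I : SemigroupIdeal M, Z = zeroLocus I := by
  constructor
  · intro hZ
    refine ⟨⟨{f | Z ⊆ (basicOpen f)ᶜ}, fun c x hx p hp hpc => hx hp fun h =>
      hpc (p.asIdeal.smul_mem c h)⟩, Set.Subset.antisymm ?_ ?_⟩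
    · intro p hp f hf
      by_contra h
      exact hf hp h
    · intro p hp
      by_contra h
      obtain ⟨_, ⟨f, rfl⟩, hpf, hf⟩ :=
        isTopologicalBasis_basicOpen.exists_subset_of_mem_open h hZ.isOpen_compl
      exact hpf (hp (show Z ⊆ (basicOpen f)ᶜ from fun q hq hqf => hf hqf hq))
  · rintro ⟨I, rfl⟩
    rw [← isOpen_compl_iff, isTopologicalBasis_basicOpen.isOpen_iff]
    intro p hp
    obtain ⟨f, hfI, hfp⟩ := SetLike.not_le_iff_exists.mp (show ¬ I ≤ p.asIdeal from hp)
    exact ⟨_, ⟨f, rfl⟩, hfp, fun q hq hIq => hq (hIq hfI)⟩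

end MSpec

/-- The spectrum as an object of `TopCat`. -/
abbrev specTop (M : Type u) [CommMonoid M] : TopCat.{u} := TopCat.of (MSpec M)

section Sections

variable (M : Type u) [CommMonoid M] (A : Type u) [MulAction M A]

/-- The localisation `A_𝔭` of the `M`-set `A` at the prime `𝔭`: the set of fractions `a / s` with
`s ∉ 𝔭`, where `a / s = b / t` iff `w • t • a = w • s • b` for some `w ∉ 𝔭`. -/
abbrev Loc (p : specTop M) : Type u := OreLocalization p.primeCompl A

/-- Families of elements of the stalks that are given by one fraction `a / s`. -/
def isFraction : TopCat.PrelocalPredicate (Loc M A) where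
  pred {U} σ := ∃ (a : A) (s : M), ∀ p : U, ∃ hs : s ∈ p.1.primeCompl,
    σ p = OreLocalization.oreDiv a ⟨s, hs⟩
  res := by rintro V U i σ ⟨a, s, h⟩; exact ⟨a, s, fun p => h ⟨p.1, leOfHom i p.2⟩⟩

/-- Families of elements of the stalks that are locally given by a fraction. -/
def isLocallyFraction : TopCat.LocalPredicate (Loc M A) := (isFraction M A).sheafify

/-- The sheaf of sets underlying `Ã`: its sections over `U` are the families in `∏_{𝔭 ∈ U} A_𝔭`
that are locally given by fractions. -/
def tildeInType : TopCat.Sheaf (Type u) (specTop M) :=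
  TopCat.subsheafToTypes (isLocallyFraction M A)

variable {M}

/-- The sections of the structure sheaf over `U`, as a submonoid of `∏_{𝔭 ∈ U} M_𝔭`. -/
def sectionsSubmonoid (U : Opens (specTop M)) : Submonoid (∀ p : U, Loc M M p.1) where
  carrier := {σ | (isLocallyFraction M M).pred σ}
  one_mem' p := ⟨U, p.2, 𝟙 _, 1, 1, fun q =>
    ⟨q.1.primeCompl.one_mem, OreLocalization.one_def⟩⟩
  mul_mem' {σ τ} hσ hτ p := by
    obtain ⟨V, hpV, i, a, s, h⟩ := hσ p
    obtain ⟨W, hpW, j, b, t, k⟩ := hτ p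
    refine ⟨V ⊓ W, ⟨hpV, hpW⟩, Opens.infLELeft _ _ ≫ i, a * b, t * s, fun q => ?_⟩
    obtain ⟨hs, hσq⟩ := h ⟨q.1, q.2.1⟩
    obtain ⟨ht, hτq⟩ := k ⟨q.1, q.2.2⟩
    refine ⟨q.1.primeCompl.mul_mem ht hs, ?_⟩
    exact congr($hσq * $hτq).trans (OreLocalization.oreDiv_mul_char a b ⟨s, hs⟩ ⟨t, ht⟩ a ⟨t, ht⟩
      (mul_comm _ _))

/-- The pointwise action of the sections of the structure sheaf preserves the sections of `Ã`. -/
theorem smul_pred {U : Opens (specTop M)} {σ : ∀ p : U, Loc M M p.1} {τ : ∀ p : U, Loc M A p.1}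
    (hσ : (isLocallyFraction M M).pred σ) (hτ : (isLocallyFraction M A).pred τ) :
    (isLocallyFraction M A).pred (fun p => σ p • τ p) := by
  intro p
  obtain ⟨V, hpV, i, a, s, h⟩ := hσ p
  obtain ⟨W, hpW, j, b, t, k⟩ := hτ p
  refine ⟨V ⊓ W, ⟨hpV, hpW⟩, Opens.infLELeft _ _ ≫ i, a • b, t * s, fun q => ?_⟩
  obtain ⟨hs, hσq⟩ := h ⟨q.1, q.2.1⟩
  obtain ⟨ht, hτq⟩ := k ⟨q.1, q.2.2⟩
  refine ⟨q.1.primeCompl.mul_mem ht hs, ?_⟩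
  exact congr($hσq • $hτq).trans (OreLocalization.oreDiv_smul_char a b ⟨s, hs⟩ ⟨t, ht⟩ a ⟨t, ht⟩
    (mul_comm _ _))

instance (U : (Opens (specTop M))ᵒᵖ) : CommMonoid ((tildeInType M M).obj.obj U) :=
  (sectionsSubmonoid (unop U)).toCommMonoid

instance instMulActionTildeInType (U : (Opens (specTop M))ᵒᵖ) :
    MulAction ((tildeInType M M).obj.obj U) ((tildeInType M A).obj.obj U) where
  smul σ τ := ⟨fun p => σ.1 p • τ.1 p, smul_pred A σ.2 τ.2⟩
  one_smul τ := Subtype.ext (funext fun p => one_smul _ (τ.1 p))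
  mul_smul σ σ' τ := Subtype.ext (funext fun p => mul_smul (σ.1 p) (σ'.1 p) (τ.1 p))

variable {A} in
/-- The section `a / 1` of the sheaf of sets underlying `Ã` over `U`, for an element `a` of `A`. -/
def constSection (a : A) (U : (Opens (specTop M))ᵒᵖ) : (tildeInType M A).obj.obj U :=
  ⟨fun _ => OreLocalization.oreDiv a 1, fun p => ⟨unop U, p.2, 𝟙 _, a, 1, fun q =>
    ⟨q.1.primeCompl.one_mem, rfl⟩⟩⟩

variable (M)

/-- The structure presheaf of `Spec M`, with values in commutative monoids. -/
def structurePresheaf : TopCat.Presheaf CommMonCat.{u} (specTop M) where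
  obj U := CommMonCat.of ((tildeInType M M).obj.obj U)
  map i := CommMonCat.ofHom
    { toFun := (tildeInType M M).obj.map i
      map_one' := rfl
      map_mul' := fun _ _ => rfl }

/-- The underlying presheaf of sets of the structure presheaf. -/
def structurePresheafCompForget :
    structurePresheaf M ⋙ forget CommMonCat ≅ (tildeInType M M).obj :=
  NatIso.ofComponents fun _ => Iso.refl _

/-- The affine monoid scheme `(Spec M, 𝒪_M)`. -/
def Spec : SheafedSpace CommMonCat.{u} where
  carrier := specTop M
  presheaf := structurePresheaf M
  IsSheaf := (TopCat.Presheaf.isSheaf_iff_isSheaf_comp (forget CommMonCat) _).mpr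
    (TopCat.Presheaf.isSheaf_of_iso (structurePresheafCompForget M).symm (tildeInType M M).property)

end Sections

/-! ### Monoid schemes -/

/-- A monoid scheme: a topological space with a sheaf of commutative monoids that is covered by
open subspaces isomorphic to spectra of commutative monoids. -/
structure MonoidScheme extends SheafedSpace CommMonCat.{u} where
  exists_affine : ∀ x : toSheafedSpace, ∃ (M : CommMonCat.{u}) (f : Spec M ⟶ toSheafedSpace),
    SheafedSpace.IsOpenImmersion f ∧ x ∈ Set.range f.hom.base

/-- A commutative monoid is `s`-Noetherian if it satisfies the ascending chain condition on
ideals. -/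
def IsSNoetherianMonoid (M : Type u) [CommMonoid M] : Prop := WellFoundedGT (SemigroupIdeal M)

/-- A monoid scheme is `s`-Noetherian if it is covered by finitely many open affine subschemes
`Spec Mᵢ` with `Mᵢ` an `s`-Noetherian monoid. -/
def MonoidScheme.IsSNoetherian (X : MonoidScheme.{u}) : Prop :=
  ∃ (n : ℕ) (M : Fin n → CommMonCat.{u}) (f : ∀ i, Spec (M i) ⟶ X.toSheafedSpace),
    (∀ i, IsSNoetherianMonoid (M i)) ∧ (∀ i, SheafedSpace.IsOpenImmersion (f i)) ∧
      ∀ x : X.toSheafedSpace, ∃ i, x ∈ Set.range (f i).hom.base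

/-! ### Sheaves of `𝒪_X`-sets -/

/-- A sheaf of `𝒪_X`-sets: a sheaf of sets with compatible actions of the monoids `𝒪_X(U)`. -/
structure OSet (X : SheafedSpace CommMonCat.{u}) where
  presheaf : TopCat.Presheaf (Type u) (X : TopCat)
  isSheaf : presheaf.IsSheaf
  mulAction : ∀ U : (Opens X)ᵒᵖ, MulAction (X.presheaf.obj U) (presheaf.obj U)
  map_smul : ∀ {U V : (Opens X)ᵒᵖ} (i : U ⟶ V) (m : X.presheaf.obj U) (a : presheaf.obj U),
    presheaf.map i (m • a) = X.presheaf.map i m • presheaf.map i a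

namespace OSet

attribute [instance] OSet.mulAction

variable {X : SheafedSpace CommMonCat.{u}}

/-- A morphism of sheaves of `𝒪_X`-sets. -/
@[ext]
structure Hom (A B : OSet X) where
  val : A.presheaf ⟶ B.presheaf
  app_smul : ∀ (U : (Opens X)ᵒᵖ) (m : X.presheaf.obj U) (a : A.presheaf.obj U),
    val.app U (m • a) = m • val.app U a

/-- The category `𝒪_X-Sets`. -/
instance : Category (OSet X) where
  Hom := Hom
  id A := ⟨𝟙 _, fun _ _ _ => rfl⟩
  comp f g := ⟨f.val ≫ g.val, fun U m a => by
    change g.val.app U (f.val.app U (m • a)) = m • g.val.app U (f.val.app U a)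
    rw [f.app_smul, g.app_smul]⟩

/-- The restriction of a sheaf of `𝒪_X`-sets along an open immersion `f : Y ⟶ X`: its sections
over `W` are the sections over `f(W)`, on which `𝒪_Y(W)` acts through `𝒪_Y(W) ≅ 𝒪_X(f(W))`. -/
def restrict {Y : SheafedSpace CommMonCat.{u}} (A : OSet X) (f : Y ⟶ X)
    [H : SheafedSpace.IsOpenImmersion f] : OSet Y where
  presheaf := (PresheafedSpace.IsOpenImmersion.opensFunctor f.hom).op ⋙ A.presheaf
  isSheaf := TopCat.Presheaf.isSheaf_of_isOpenEmbedding H.base_open A.isSheaf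
  mulAction W :=
    letI := A.mulAction (op ((PresheafedSpace.IsOpenImmersion.opensFunctor f.hom).obj (unop W)))
    MulAction.compHom
      (A.presheaf.obj (op ((PresheafedSpace.IsOpenImmersion.opensFunctor f.hom).obj (unop W))))
      (PresheafedSpace.IsOpenImmersion.invApp f.hom (unop W)).hom
  map_smul {W W'} i m a := by
    refine (A.map_smul _ _ _).trans ?_
    exact congrArg (· • (A.presheaf.map _ a))
      (ConcreteCategory.congr_hom (PresheafedSpace.IsOpenImmersion.inv_naturality f.hom i) m).symm

/-- The restriction of a morphism of sheaves of `𝒪_X`-sets along an open immersion. -/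
def restrictMap {Y : SheafedSpace CommMonCat.{u}} {A B : OSet X} (φ : A ⟶ B) (f : Y ⟶ X)
    [SheafedSpace.IsOpenImmersion f] : A.restrict f ⟶ B.restrict f where
  val := Functor.whiskerLeft (PresheafedSpace.IsOpenImmersion.opensFunctor f.hom).op φ.val
  app_smul W m a := φ.app_smul (op ((PresheafedSpace.IsOpenImmersion.opensFunctor f.hom).obj
    (unop W))) ((PresheafedSpace.IsOpenImmersion.invApp f.hom (unop W)) m) a

end OSet

/-- The sheaf `Ã` of `𝒪_M`-sets on `Spec M` associated with an `M`-set `A`. -/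
def tilde (M : Type u) [CommMonoid M] (A : Type u) [MulAction M A] : OSet (Spec M) where
  presheaf := (tildeInType M A).obj
  isSheaf := (tildeInType M A).property
  mulAction U := instMulActionTildeInType A U
  map_smul _ _ _ := rfl

/-- The section `a / 1` of `Ã` over `U`, for an element `a` of `A`. -/
def tildeSection (M : Type u) [CommMonoid M] {A : Type u} [MulAction M A] (a : A)
    (U : (Opens (Spec M))ᵒᵖ) : (tilde M A).presheaf.obj U :=
  constSection a U

/-- A sheaf of `𝒪_X`-sets is quasi-coherent if every point has an open affine neighbourhood
`Spec M` on which it is isomorphic to `Ã` for some `M`-set `A`. -/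
def isQuasicoherent (X : SheafedSpace CommMonCat.{u}) : ObjectProperty (OSet X) := fun F =>
  ∀ x : X, ∃ (M : CommMonCat.{u}) (f : Spec M ⟶ X) (_ : SheafedSpace.IsOpenImmersion f),
    x ∈ Set.range f.hom.base ∧
      ∃ (A : Type u) (_ : MulAction M A), Nonempty (F.restrict f ≅ tilde M A)

/-- The category `Qc(X)` of quasi-coherent sheaves on a monoid scheme `X`. -/
abbrev Qc (X : MonoidScheme.{u}) := (isQuasicoherent X.toSheafedSpace).FullSubcategory

/-! ### The `M`-set of ideals -/

/-- The set `Ω^M` of ideals of `M` (including the empty one). -/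
def Omega (M : Type u) [CommMonoid M] : Type u := SemigroupIdeal M

namespace Omega

variable {M : Type u} [CommMonoid M]

/-- The ideal `(𝔪 : a) = {x | a * x ∈ 𝔪}`. -/
def colon (I : SemigroupIdeal M) (a : M) : SemigroupIdeal M where
  carrier := {x | a * x ∈ I}
  smul_mem' c x hx := by
    change a * (c * x) ∈ I
    rw [mul_left_comm]
    exact I.smul_mem c hx

theorem colon_one (I : SemigroupIdeal M) : colon I 1 = I :=
  SetLike.ext fun x => by
    change 1 * x ∈ I ↔ x ∈ I
    rw [one_mul]

theorem colon_mul (I : SemigroupIdeal M) (a b : M) : colon I (a * b) = colon (colon I b) a :=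
  SetLike.ext fun x => by
    change a * b * x ∈ I ↔ b * (a * x) ∈ I
    rw [mul_assoc, mul_left_comm]

/-- The action of `M` on `Ω^M`, by `a • 𝔪 = (𝔪 : a)`. -/
instance : MulAction M (Omega M) where
  smul a I := colon I a
  one_smul I := colon_one I
  mul_smul a b I := colon_mul I a b

/-- The truth value `M ∈ Ω^M`. -/
def top : Omega M := (⊤ : SemigroupIdeal M)

end Omega

end MonoidGeometry

end

/-!
# The sheaf of ideals is a subobject classifier for quasi-coherent sheaves

In a monoid scheme, an affine open subset `Spec M` has a closed point (the ideal of non-units) whose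
only neighbourhood in `Spec M` is `Spec M` itself. Such open sets, called local here, form a basis,
and some member of every open cover of a local open set contains all of it. So a sheaf is determined
by its restriction to the local open sets, with no gluing condition left: over a local open set, a
section of `Ã` is one fraction (`exists_fraction`).

This makes quasi-coherence a statement about sections. A sheaf is called cartesian if for local open
sets `V ⊆ U` the restriction `F(U) → F(V)` is the localisation at the sections of `𝒪_X(U)` that
become invertible on `V`. The sheaves `Ã` are cartesian (`tilde_isCartesian`), and a cartesian sheaf
on `Spec M` is determined by its global sections (`OSet.IsCartesian.exists_iso`); so the
quasi-coherent sheaves are the cartesian ones (`MonoidScheme.isQuasicoherent_iff_isCartesian`).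

The sheaf `Ω^X` has as sections over `U` the families of ideals `J_V ⊆ 𝒪_X(V)`, for `V ⊆ U` local,
with `J_V 𝒪_X(W) = J_W` for `W ⊆ V`. Over a local open set it is the set of ideals of `𝒪_X(U)`. It
is cartesian because of the `s`-Noetherian hypothesis: every ideal of a localisation is extended,
and if two ideals have the same extension then a single denominator `s` satisfies
`(I : s) = (I' : s)`, as the ideals `(I : s)` have a maximal member
(`IsLocalizationHom.exists_colon_eq_colon`).

Localisation commutes with fibre products, so fibre products in `Qc(X)` are formed on sections.
Hence monomorphisms are injective on sections, and pullback squares may be tested on sections. The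
characteristic morphism of `m : F ⟶ G` sends `g` to the ideals `{a | a • g ∈ m(F(V))}`, and it is
the only one because `a ∈ J` is equivalent to `(J : a)` being the unit ideal.
-/

noncomputable section

namespace MonoidGeometry

/-! ### Local open sets -/

section LocalOpens

/-- An open set is local if it has a point, called a centre here, all of whose open neighbourhoods
contain the set. Some member of every open cover of such a set contains all of it, so the sheaf
condition is void there. The local open sets of a monoid scheme are its affine open sets. -/
def IsLocalOpen {Y : Type*} [TopologicalSpace Y] (V : Opens Y) : Prop :=
  ∃ x ∈ V, ∀ W : Opens Y, x ∈ W → V ≤ W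

/-- The local open sets form a basis of the topology. -/
def HasLocalBasis (Y : Type*) [TopologicalSpace Y] : Prop :=
  ∀ (x : Y) (U : Opens Y), x ∈ U → ∃ V : Opens Y, IsLocalOpen V ∧ x ∈ V ∧ V ≤ U

theorem HasLocalBasis.isBasis {Y : Type*} [TopologicalSpace Y] (h : HasLocalBasis Y) :
    Opens.IsBasis (Set.range (Subtype.val : {V : Opens Y // IsLocalOpen V} → Opens Y)) := by
  rw [Opens.isBasis_iff_nbhd]
  intro U x hx
  obtain ⟨V, hV, hxV, hVU⟩ := h x U hx
  exact ⟨V, ⟨⟨V, hV⟩, rfl⟩, hxV, hVU⟩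

end LocalOpens

/-! ### Sections of sheaves of sets with an action -/

namespace OSet

variable {X : SheafedSpace.{u + 1, u, u} CommMonCat.{u}}

/-- The sheaf underlying a sheaf of `𝒪_X`-sets. -/
abbrev toSheaf (F : OSet X) : TopCat.Sheaf (Type u) (X : TopCat) := ⟨F.presheaf, F.isSheaf⟩

/-- The sections over an open set. -/
abbrev Sec (F : OSet X) (U : Opens X) : Type u := F.presheaf.obj (op U)

/-- Restriction of sections to a smaller open set. -/
def res (F : OSet X) {U V : Opens X} (h : V ≤ U) (a : F.Sec U) : F.Sec V :=
  F.presheaf.map (homOfLE h).op a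

/-- Restriction of sections of the structure sheaf to a smaller open set. -/
def ores (X : SheafedSpace.{u + 1, u, u} CommMonCat.{u}) {U V : Opens X} (h : V ≤ U) :
    X.presheaf.obj (op U) →* X.presheaf.obj (op V) :=
  (X.presheaf.map (homOfLE h).op).hom

theorem ores_ores {U V W : Opens X} (h : V ≤ U) (h' : W ≤ V) (m : X.presheaf.obj (op U)) :
    ores X h' (ores X h m) = ores X (h'.trans h) m :=
  (ConcreteCategory.congr_hom (X.presheaf.map_comp (homOfLE h).op (homOfLE h').op) m).symm

theorem ores_self {U : Opens X} (m : X.presheaf.obj (op U)) : ores X le_rfl m = m :=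
  ConcreteCategory.congr_hom (X.presheaf.map_id (op U)) m

variable (F : OSet X)

theorem res_res {U V W : Opens X} (h : V ≤ U) (h' : W ≤ V) (a : F.Sec U) :
    F.res h' (F.res h a) = F.res (h'.trans h) a :=
  (ConcreteCategory.congr_hom (F.presheaf.map_comp (homOfLE h).op (homOfLE h').op) a).symm

theorem res_self {U : Opens X} (a : F.Sec U) : F.res le_rfl a = a :=
  ConcreteCategory.congr_hom (F.presheaf.map_id (op U)) a

theorem res_smul {U V : Opens X} (h : V ≤ U) (m : X.presheaf.obj (op U)) (a : F.Sec U) :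
    F.res h (m • a) = ores X h m • F.res h a :=
  F.map_smul _ m a

/-- Two sections agree if they agree near every point. -/
theorem eq_of_locally_eq {U : Opens X} (a b : F.Sec U)
    (h : ∀ x ∈ U, ∃ (V : Opens X) (hV : V ≤ U), x ∈ V ∧ F.res hV a = F.res hV b) : a = b := by
  choose V hV hxV hab using h
  refine F.toSheaf.eq_of_locally_eq' (fun x : U => V x.1 x.2) U (fun x => homOfLE (hV x.1 x.2))
    ?_ a b fun x => hab x.1 x.2
  intro x hx
  exact Opens.mem_iSup.mpr ⟨⟨x, hx⟩, hxV x hx⟩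

theorem eq_of_eq_local (hX : HasLocalBasis X) {U : Opens X} (a b : F.Sec U)
    (h : ∀ (V : Opens X) (hV : V ≤ U), IsLocalOpen V → F.res hV a = F.res hV b) : a = b :=
  F.eq_of_locally_eq a b fun x hx => by
    obtain ⟨V, hV, hxV, hVU⟩ := hX x U hx
    exact ⟨V, hVU, hxV, h V hVU hV⟩

variable {F} {G : OSet X}

/-- The map on sections induced by a morphism. -/
def Hom.on (φ : F ⟶ G) (U : Opens X) (a : F.Sec U) : G.Sec U := φ.val.app (op U) a

theorem Hom.on_smul (φ : F ⟶ G) {U : Opens X} (m : X.presheaf.obj (op U)) (a : F.Sec U) :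
    Hom.on φ U (m • a) = m • Hom.on φ U a :=
  φ.app_smul _ m a

theorem Hom.on_res (φ : F ⟶ G) {U V : Opens X} (h : V ≤ U) (a : F.Sec U) :
    Hom.on φ V (F.res h a) = G.res h (Hom.on φ U a) :=
  ConcreteCategory.congr_hom (φ.val.naturality (homOfLE h).op) a

theorem Hom.on_comp {H : OSet X} (φ : F ⟶ G) (ψ : G ⟶ H) (U : Opens X) (a : F.Sec U) :
    Hom.on (φ ≫ ψ) U a = Hom.on ψ U (Hom.on φ U a) := rfl

theorem Hom.on_id (U : Opens X) (a : F.Sec U) : Hom.on (𝟙 F) U a = a := rfl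

theorem Hom.ext_on {φ ψ : F ⟶ G} (h : ∀ U (a : F.Sec U), Hom.on φ U a = Hom.on ψ U a) :
    φ = ψ := by
  refine Hom.ext (NatTrans.ext (funext fun U => ?_))
  ext a
  exact h (unop U) a

theorem Hom.ext_local (hX : HasLocalBasis X) {φ ψ : F ⟶ G}
    (h : ∀ U, IsLocalOpen U → ∀ a : F.Sec U, Hom.on φ U a = Hom.on ψ U a) : φ = ψ :=
  Hom.ext_on fun U a => G.eq_of_eq_local hX _ _ fun V hV hl => by
    rw [← Hom.on_res, ← Hom.on_res, h V hl]

/-- Morphisms from equivariant maps on sections that commute with restriction. -/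
def homMk (φ : ∀ U, F.Sec U → G.Sec U)
    (hs : ∀ U (m : X.presheaf.obj (op U)) a, φ U (m • a) = m • φ U a)
    (hr : ∀ {U V : Opens X} (h : V ≤ U) (a : F.Sec U), φ V (F.res h a) = G.res h (φ U a)) :
    F ⟶ G where
  val :=
    { app := fun U => TypeCat.ofHom (φ (unop U))
      naturality := fun U V i => by
        ext a
        exact hr (leOfHom i.unop) a }
  app_smul U m a := hs (unop U) m a

/-- On a space with a basis of local open sets, a morphism of sheaves may be given on the local
open sets only. -/
theorem exists_hom_of_local (hX : HasLocalBasis X) (φ : ∀ U, IsLocalOpen U → F.Sec U → G.Sec U)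
    (hs : ∀ U (hU : IsLocalOpen U) (m : X.presheaf.obj (op U)) a, φ U hU (m • a) = m • φ U hU a)
    (hr : ∀ {U V : Opens X} (hU : IsLocalOpen U) (hV : IsLocalOpen V) (h : V ≤ U) (a : F.Sec U),
      φ V hV (F.res h a) = G.res h (φ U hU a)) :
    ∃ Φ : F ⟶ G, ∀ U (hU : IsLocalOpen U) a, Hom.on Φ U a = φ U hU a := by
  let B : {V : Opens X // IsLocalOpen V} → Opens X := Subtype.val
  let α : (inducedFunctor B).op ⋙ F.presheaf ⟶ (inducedFunctor B).op ⋙ G.toSheaf.1 :=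
    { app := fun U => TypeCat.ofHom (φ (unop U).1 (unop U).2)
      naturality := fun U V i => by
        ext a
        exact hr (unop U).2 (unop V).2 (leOfHom ((inducedFunctor B).map i.unop)) a }
  let β : F.presheaf ⟶ G.presheaf :=
    TopCat.Sheaf.restrictHomEquivHom F.presheaf G.toSheaf hX.isBasis α
  have hβ : ∀ U (hU : IsLocalOpen U) a, β.app (op U) a = φ U hU a := fun U hU a =>
    ConcreteCategory.congr_hom
      (TopCat.Sheaf.extend_hom_app F.presheaf G.toSheaf hX.isBasis α ⟨U, hU⟩) a
  have hn : ∀ {U V : Opens X} (h : V ≤ U) (a : F.Sec U),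
      β.app (op V) (F.res h a) = G.res h (β.app (op U) a) := fun h a =>
    ConcreteCategory.congr_hom (β.naturality (homOfLE h).op) a
  refine ⟨homMk (fun U => β.app (op U)) (fun U m a => ?_) hn, hβ⟩
  refine G.eq_of_eq_local hX _ _ fun V hV hl => ?_
  rw [← hn, F.res_smul, hβ V hl, hs, G.res_smul, ← hn, hβ V hl]

/-! ### Localisation along an inclusion of open sets -/

/-- The restriction `F(U) → F(V)` is the localisation of `F(U)` at the sections of `𝒪_X` over `U`
that are invertible over `V`. -/
structure IsLocalizationAlong (F : OSet X) {U V : Opens X} (h : V ≤ U) : Prop where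
  surj : ∀ b : F.Sec V, ∃ s : X.presheaf.obj (op U), IsUnit (ores X h s) ∧
    ∃ a : F.Sec U, ores X h s • b = F.res h a
  inj : ∀ a a' : F.Sec U, F.res h a = F.res h a' → ∃ s : X.presheaf.obj (op U),
    IsUnit (ores X h s) ∧ s • a = s • a'

/-- A sheaf is cartesian if its restriction maps between local open sets are localisations. For
monoid schemes, this is quasi-coherence. -/
def IsCartesian (F : OSet X) : Prop :=
  ∀ ⦃U V : Opens X⦄, IsLocalOpen U → IsLocalOpen V → ∀ h : V ≤ U, F.IsLocalizationAlong h

theorem isUnit_ores_mono {U V W : Opens X} (h : V ≤ U) (h' : W ≤ V) {s : X.presheaf.obj (op U)}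
    (hs : IsUnit (ores X h s)) : IsUnit (ores X (h'.trans h) s) := by
  rw [← ores_ores h h']
  exact hs.map _

theorem smul_left_cancel_of_isUnit {U : Opens X} {s : X.presheaf.obj (op U)} (hs : IsUnit s)
    {a b : F.Sec U} (h : s • a = s • b) : a = b := by
  obtain ⟨s, rfl⟩ := hs
  have := congrArg (fun c => ((s⁻¹ : (X.presheaf.obj (op U))ˣ) : X.presheaf.obj (op U)) • c) h
  simpa [smul_smul] using this

theorem exists_smul_eq_of_isUnit {U : Opens X} {s : X.presheaf.obj (op U)} (hs : IsUnit s)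
    (a : F.Sec U) : ∃ b : F.Sec U, s • b = a := by
  obtain ⟨s, rfl⟩ := hs
  exact ⟨((s⁻¹ : (X.presheaf.obj (op U))ˣ) : X.presheaf.obj (op U)) • a, by simp [smul_smul]⟩

theorem IsLocalizationAlong.of_iso (e : F ≅ G) {U V : Opens X} {h : V ≤ U}
    (hF : F.IsLocalizationAlong h) : G.IsLocalizationAlong h := by
  have h1 : ∀ W (b : G.Sec W), Hom.on e.hom W (Hom.on e.inv W b) = b := fun W b => by
    rw [← Hom.on_comp, e.inv_hom_id, Hom.on_id]
  constructor
  · intro b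
    obtain ⟨s, hs, a, ha⟩ := hF.surj (Hom.on e.inv V b)
    exact ⟨s, hs, Hom.on e.hom U a, by rw [← Hom.on_res, ← ha, Hom.on_smul, h1]⟩
  · intro a a' haa
    obtain ⟨s, hs, hsa⟩ := hF.inj (Hom.on e.inv U a) (Hom.on e.inv U a')
      (by rw [← Hom.on_res, ← Hom.on_res, haa] )
    refine ⟨s, hs, ?_⟩
    have h2 := congrArg (Hom.on e.hom U) hsa
    rwa [Hom.on_smul, Hom.on_smul, h1, h1] at h2

theorem IsCartesian.of_iso (e : F ≅ G) (hF : F.IsCartesian) : G.IsCartesian :=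
  fun _ _ hU hV h => (hF hU hV h).of_iso e

variable (X) in
/-- The structure sheaf as a sheaf of `𝒪_X`-sets. -/
def struct : OSet X where
  presheaf := X.presheaf ⋙ forget CommMonCat
  isSheaf := (TopCat.Presheaf.isSheaf_iff_isSheaf_comp (forget CommMonCat) _).mp X.IsSheaf
  mulAction U := inferInstanceAs (MulAction (X.presheaf.obj U) (X.presheaf.obj U))
  map_smul i m a := map_mul (X.presheaf.map i).hom m a

/-- On a local space, a cartesian sheaf is determined by its global sections: every equivariant map
from them to the global sections of a sheaf extends to a morphism. -/
theorem IsCartesian.exists_hom (hX : HasLocalBasis X) (ht : IsLocalOpen (⊤ : Opens X))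
    (hF : F.IsCartesian) (hO : (struct X).IsCartesian) (φ : F.Sec ⊤ → G.Sec ⊤)
    (hφ : ∀ (m : X.presheaf.obj (op ⊤)) a, φ (m • a) = m • φ a) :
    ∃ Φ : F ⟶ G, Hom.on Φ ⊤ = φ := by
  -- `c` corresponds to `b` if, for some fraction `b = a / s`, also `c = φ a / s`
  let R : ∀ U : Opens X, F.Sec U → G.Sec U → Prop := fun U b c =>
    ∃ s : X.presheaf.obj (op ⊤), IsUnit (ores X (le_top : U ≤ ⊤) s) ∧
      ∃ a : F.Sec ⊤, ores X (le_top : U ≤ ⊤) s • b = F.res le_top a ∧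
        ores X (le_top : U ≤ ⊤) s • c = G.res le_top (φ a)
  have hex : ∀ U, IsLocalOpen U → ∀ b, ∃ c, R U b c := by
    intro U hU b
    obtain ⟨s, hs, a, ha⟩ := (hF ht hU le_top).surj b
    obtain ⟨c, hc⟩ := exists_smul_eq_of_isUnit hs (G.res le_top (φ a))
    exact ⟨c, s, hs, a, ha, hc⟩
  have huniq : ∀ U, IsLocalOpen U → ∀ b c c', R U b c → R U b c' → c = c' := by
    rintro U hU b c c' ⟨s, hs, a, ha, hc⟩ ⟨s', hs', a', ha', hc'⟩
    obtain ⟨t, ht, hta⟩ := (hF ht hU le_top).inj (s' • a) (s • a') (by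
      rw [F.res_smul, F.res_smul, ← ha, ← ha', smul_smul, smul_smul, mul_comm])
    refine smul_left_cancel_of_isUnit ((ht.mul hs).mul hs') ?_
    have h1 := congrArg (fun z => G.res le_top (φ z) : F.Sec ⊤ → G.Sec U) hta
    simp only [hφ, G.res_smul, ← hc, ← hc', smul_smul] at h1
    rwa [map_mul, map_mul, mul_right_comm] at h1
  choose f hf using hex
  obtain ⟨Φ, hΦ⟩ := exists_hom_of_local (F := F) (G := G) hX f
    (by
      intro U hU m b
      refine huniq U hU _ _ _ (hf U hU _) ?_
      obtain ⟨s, hs, a, ha, hc⟩ := hf U hU b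
      obtain ⟨t, ht, (n : X.presheaf.obj (op ⊤)), hn⟩ := (hO ht hU le_top).surj m
      have hn' : ores X le_top t * m = ores X le_top n := hn
      refine ⟨t * s, by rw [map_mul]; exact ht.mul hs, n • a, ?_, ?_⟩
      · rw [F.res_smul, ← ha, ← hn', map_mul, smul_smul, smul_smul, mul_right_comm]
      · rw [hφ, G.res_smul, ← hc, ← hn', map_mul, smul_smul, smul_smul, mul_right_comm])
    (by
      intro U V hU hV h b
      refine huniq V hV _ _ _ (hf V hV _) ?_
      obtain ⟨s, hs, a, ha, hc⟩ := hf U hU b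
      refine ⟨s, isUnit_ores_mono le_top h hs, a, ?_, ?_⟩
      · rw [← ores_ores le_top h, ← F.res_smul, ha, F.res_res]
      · rw [← ores_ores le_top h, ← G.res_smul, hc, G.res_res])
  refine ⟨Φ, funext fun a => ?_⟩
  rw [hΦ ⊤ ht]
  refine huniq ⊤ ht _ _ _ (hf ⊤ ht a) ⟨1, by rw [map_one]; exact isUnit_one, a, ?_, ?_⟩
  · rw [map_one, one_smul]; exact (F.res_self a).symm
  · rw [map_one, one_smul]; exact (G.res_self _).symm

theorem IsCartesian.hom_ext (hX : HasLocalBasis X) (ht : IsLocalOpen (⊤ : Opens X))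
    (hF : F.IsCartesian) {φ ψ : F ⟶ G} (h : Hom.on φ ⊤ = Hom.on ψ ⊤) : φ = ψ :=
  Hom.ext_local hX fun U hU b => by
    obtain ⟨s, hs, a, ha⟩ := (hF ht hU le_top).surj b
    refine smul_left_cancel_of_isUnit hs ?_
    rw [← Hom.on_smul, ← Hom.on_smul, ha, Hom.on_res, Hom.on_res, h]

/-- On a local space, cartesian sheaves with isomorphic global sections are isomorphic. -/
theorem IsCartesian.exists_iso (hX : HasLocalBasis X) (ht : IsLocalOpen (⊤ : Opens X))
    (hO : (struct X).IsCartesian) (hF : F.IsCartesian) (hG : G.IsCartesian)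
    (φ : F.Sec ⊤ ≃ G.Sec ⊤) (hφ : ∀ (m : X.presheaf.obj (op ⊤)) a, φ (m • a) = m • φ a) :
    ∃ e : F ≅ G, Hom.on e.hom ⊤ = φ := by
  obtain ⟨Φ, hΦ⟩ := hF.exists_hom hX ht hO φ hφ
  obtain ⟨Ψ, hΨ⟩ := hG.exists_hom (G := F) hX ht hO φ.symm fun m a => by
    rw [Equiv.symm_apply_eq, hφ, Equiv.apply_symm_apply]
  refine ⟨⟨Φ, Ψ, hF.hom_ext hX ht (funext fun a => ?_), hG.hom_ext hX ht (funext fun a => ?_)⟩, hΦ⟩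
  · rw [Hom.on_comp, hΦ, hΨ, Hom.on_id, Equiv.symm_apply_apply]
  · rw [Hom.on_comp, hΦ, hΨ, Hom.on_id, Equiv.apply_symm_apply]

end OSet

/-! ### Restriction along open immersions -/

namespace OSet

variable {X Y : SheafedSpace.{u + 1, u, u} CommMonCat.{u}} (f : Y ⟶ X)
  [H : SheafedSpace.IsOpenImmersion f]

/-- The image of an open set under an open immersion. -/
abbrev im (U : Opens Y) : Opens X := (PresheafedSpace.IsOpenImmersion.opensFunctor f.hom).obj U

theorem im_mono {U V : Opens Y} (h : V ≤ U) : im f V ≤ im f U := Set.image_mono h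

theorem mem_im {U : Opens Y} {y : Y} : f.hom.base y ∈ im f U ↔ y ∈ U :=
  H.base_open.injective.mem_set_image

theorem exists_im_eq {U : Opens X} (h : ∀ x ∈ U, x ∈ Set.range f.hom.base) :
    ∃ V, im f V = U :=
  ⟨(Opens.map f.hom.base).obj U, Opens.ext (Set.image_preimage_eq_of_subset h)⟩

theorem im_le_im {U V : Opens Y} : im f V ≤ im f U ↔ V ≤ U :=
  Set.image_subset_image_iff H.base_open.injective

theorem isLocalOpen_im {U : Opens Y} : IsLocalOpen (im f U) ↔ IsLocalOpen U := by
  constructor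
  · rintro ⟨_, ⟨y, hy, rfl⟩, h⟩
    exact ⟨y, hy, fun W hW => (im_le_im f).mp (h _ ((mem_im f).mpr hW))⟩
  · rintro ⟨y, hy, h⟩
    refine ⟨_, (mem_im f).mpr hy, fun W hW => ?_⟩
    rintro _ ⟨z, hz, rfl⟩
    exact h ((Opens.map f.hom.base).obj W) hW hz

/-- The isomorphism `𝒪_Y(U) ≅ 𝒪_X(f(U))` of an open immersion. -/
def imEquiv (U : Opens Y) : Y.presheaf.obj (op U) ≃* X.presheaf.obj (op (im f U)) :=
  (asIso (PresheafedSpace.IsOpenImmersion.invApp f.hom U)).commMonCatIsoToMulEquiv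

theorem imEquiv_ores {U V : Opens Y} (h : V ≤ U) (m : Y.presheaf.obj (op U)) :
    imEquiv f V (ores Y h m) = ores X (im_mono f h) (imEquiv f U m) :=
  ConcreteCategory.congr_hom
    (PresheafedSpace.IsOpenImmersion.inv_naturality f.hom (homOfLE h).op) m

theorem isUnit_ores_imEquiv {U V : Opens Y} (h : V ≤ U) (m : Y.presheaf.obj (op U)) :
    IsUnit (ores X (im_mono f h) (imEquiv f U m)) ↔ IsUnit (ores Y h m) := by
  rw [← imEquiv_ores, MulEquiv.isUnit_map]

theorem isLocalizationAlong_restrict (F : OSet X) {U V : Opens Y} (h : V ≤ U) :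
    (F.restrict f).IsLocalizationAlong h ↔ F.IsLocalizationAlong (im_mono f h) := by
  constructor
  · intro hF
    constructor
    · intro b
      obtain ⟨s, hs, a, ha⟩ := hF.surj b
      refine ⟨imEquiv f U s, (isUnit_ores_imEquiv f h s).mpr hs, a, ?_⟩
      rw [← imEquiv_ores]
      exact ha
    · intro a a' haa
      obtain ⟨s, hs, hsa⟩ := hF.inj a a' haa
      exact ⟨imEquiv f U s, (isUnit_ores_imEquiv f h s).mpr hs, hsa⟩
  · intro hF
    constructor
    · intro b
      obtain ⟨s, hs, a, ha⟩ := hF.surj b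
      obtain ⟨s, rfl⟩ := (imEquiv f U).surjective s
      refine ⟨s, (isUnit_ores_imEquiv f h s).mp hs, a, ?_⟩
      rw [← imEquiv_ores] at ha
      exact ha
    · intro a a' haa
      obtain ⟨s, hs, hsa⟩ := hF.inj a a' haa
      obtain ⟨s, rfl⟩ := (imEquiv f U).surjective s
      exact ⟨s, (isUnit_ores_imEquiv f h s).mp hs, hsa⟩

theorem IsCartesian.restrict {F : OSet X} (hF : F.IsCartesian) : (F.restrict f).IsCartesian :=
  fun _ _ hU hV h => (isLocalizationAlong_restrict f F h).mpr
    (hF ((isLocalOpen_im f).mpr hU) ((isLocalOpen_im f).mpr hV) _)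

/-- The structure sheaf restricts to the structure sheaf. -/
def structRestrictIso : struct Y ≅ (struct X).restrict f where
  hom := homMk (F := struct Y) (G := (struct X).restrict f) (fun U m => imEquiv f U m)
    (fun U m a => map_mul (imEquiv f U) m a) (fun h a => imEquiv_ores f h a)
  inv := homMk (F := (struct X).restrict f) (G := struct Y) (fun U m => (imEquiv f U).symm m)
    (fun U m a => (imEquiv f U).symm_apply_eq.mpr
      ((congrArg (imEquiv f U m * ·) ((imEquiv f U).apply_symm_apply a)).symm.trans
        (map_mul (imEquiv f U) m _).symm))
    (fun {U V} h a => (imEquiv f V).symm_apply_eq.mpr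
      ((congrArg (ores X (im_mono f h)) ((imEquiv f U).apply_symm_apply a)).symm.trans
        (imEquiv_ores f h _).symm))
  hom_inv_id := Hom.ext_on fun U a => (imEquiv f U).symm_apply_apply a
  inv_hom_id := Hom.ext_on fun U a => (imEquiv f U).apply_symm_apply a

/-- Being cartesian may be checked on an open cover. -/
theorem isCartesian_of_cover {F : OSet X}
    (h : ∀ x : X, ∃ (Y : SheafedSpace.{u + 1, u, u} CommMonCat.{u}) (f : Y ⟶ X)
      (_ : SheafedSpace.IsOpenImmersion f), x ∈ Set.range f.hom.base ∧
        (F.restrict f).IsCartesian) : F.IsCartesian := by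
  intro U V hU hV hVU
  obtain ⟨x, -, hx⟩ := id hU
  obtain ⟨Y, f, hf, ⟨y, rfl⟩, hF⟩ := h x
  have hr : U ≤ im f ⊤ := hx _ ((mem_im f).mpr trivial)
  have hr' : ∀ x ∈ U, x ∈ Set.range f.hom.base := fun x hx =>
    Set.image_subset_range _ _ (hr hx)
  obtain ⟨U, rfl⟩ := exists_im_eq f hr'
  obtain ⟨V, rfl⟩ := exists_im_eq f (fun x hx => hr' x (hVU hx))
  exact (isLocalizationAlong_restrict f F ((im_le_im f).mp hVU)).mp
    (hF ((isLocalOpen_im f).mp hU) ((isLocalOpen_im f).mp hV) _)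

end OSet

/-! ### Affine monoid schemes -/

namespace MSpec

variable {M : Type u} [CommMonoid M]

/-- The set `D(f)` as an open set. -/
def D (f : M) : Opens (MSpec M) := ⟨basicOpen f, isTopologicalBasis_basicOpen.isOpen ⟨f, rfl⟩⟩

theorem pow_notMem {p : MSpec M} {f : M} (h : f ∉ p.asIdeal) (n : ℕ) : f ^ n ∉ p.asIdeal :=
  p.primeCompl.pow_mem h n

theorem notMem_of_dvd {p : MSpec M} {a b : M} (hab : a ∣ b) (h : b ∉ p.asIdeal) :
    a ∉ p.asIdeal := by
  obtain ⟨c, rfl⟩ := hab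
  exact fun ha => h (by rw [mul_comm]; exact p.asIdeal.smul_mem c ha)

/-- The largest prime ideal that does not contain `f`: its elements are those that do not divide
any power of `f`. -/
def centre (f : M) : MSpec M where
  asIdeal :=
    { carrier := {x | ∀ n : ℕ, ¬ x ∣ f ^ n}
      smul_mem' := fun c _ hx n h => hx n ((Dvd.intro_left c rfl).trans h) }
  one_notMem h := h 0 (one_dvd _)
  mem_or_mem a b h := by
    by_contra! hab
    obtain ⟨n, hn⟩ := not_forall_not.mp hab.1
    obtain ⟨m, hm⟩ := not_forall_not.mp hab.2
    exact h (n + m) (by rw [pow_add]; exact mul_dvd_mul hn hm)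

theorem notMem_centre {f x : M} : x ∉ (centre f).asIdeal ↔ ∃ n : ℕ, x ∣ f ^ n :=
  not_forall_not

theorem exists_D_le {p : MSpec M} {U : Opens (MSpec M)} (h : p ∈ U) :
    ∃ f : M, p ∈ D f ∧ D f ≤ U := by
  obtain ⟨_, ⟨f, rfl⟩, hp, hf⟩ := isTopologicalBasis_basicOpen.exists_subset_of_mem_open h U.isOpen
  exact ⟨f, hp, hf⟩

theorem centre_mem (f : M) : centre f ∈ D f := notMem_centre.mpr ⟨1, by rw [pow_one]⟩

theorem D_le_of_centre_mem {f : M} {U : Opens (MSpec M)} (h : centre f ∈ U) : D f ≤ U := by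
  obtain ⟨g, hg, hgU⟩ := exists_D_le h
  obtain ⟨n, hn⟩ := notMem_centre.mp hg
  exact le_trans (fun q hq => notMem_of_dvd hn (pow_notMem hq n)) hgU

theorem isLocalOpen_D (f : M) : IsLocalOpen (D f) :=
  ⟨centre f, centre_mem f, fun _ => D_le_of_centre_mem⟩

theorem D_one : D (1 : M) = ⊤ := Opens.ext (Set.eq_univ_of_forall fun p => p.one_notMem)

variable (M) in
theorem isLocalOpen_top : IsLocalOpen (⊤ : Opens (MSpec M)) := D_one (M := M) ▸ isLocalOpen_D 1

variable (M) in
theorem hasLocalBasis : HasLocalBasis (MSpec M) := fun p U hp => by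
  obtain ⟨f, hpf, hf⟩ := exists_D_le hp
  exact ⟨D f, isLocalOpen_D f, hpf, hf⟩

end MSpec

section Tilde

open MSpec OSet

variable {M : Type u} [CommMonoid M] {A : Type u} [MulAction M A]

/-- Over a local open set a section of `Ã` is a single fraction. -/
theorem exists_fraction {U : Opens (Spec M)} (hU : IsLocalOpen U) (σ : (tilde M A).Sec U) :
    ∃ (a : A) (s : M), ∀ p : U, ∃ hs : s ∈ p.1.primeCompl,
      σ.1 p = OreLocalization.oreDiv a ⟨s, hs⟩ := by
  obtain ⟨x, hx, hxU⟩ := hU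
  obtain ⟨V, hxV, i, a, s, h⟩ := σ.2 ⟨x, hx⟩
  exact ⟨a, s, fun p => h ⟨p.1, hxU V hxV p.2⟩⟩

theorem loc_div_eq_iff {p : specTop M} {a b : A} {s t : p.primeCompl} :
    (OreLocalization.oreDiv a s : Loc M A p) = OreLocalization.oreDiv b t ↔
      ∃ w ∈ p.primeCompl, w • t.1 • a = w • s.1 • b := by
  rw [OreLocalization.oreDiv_eq_iff]
  constructor
  · rintro ⟨u, v, h, h'⟩
    refine ⟨u, u.2, ?_⟩
    rw [smul_smul, h', mul_comm v, mul_smul, ← h, Submonoid.smul_def, smul_comm]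
  · rintro ⟨w, hw, h⟩
    refine ⟨⟨w, hw⟩ * s, w * t.1, ?_, mul_right_comm _ _ _⟩
    rw [mul_smul w, h, mul_smul]
    rfl

theorem loc_smul_div {p : specTop M} (m : M) (a : A) (s : p.primeCompl) :
    (OreLocalization.oreDiv m 1 : Loc M M p) • (OreLocalization.oreDiv a s : Loc M A p) =
      OreLocalization.oreDiv (m • a) s := by
  rw [OreLocalization.oreDiv_smul_char m a 1 s m s (by simp [mul_comm])]
  simp

theorem isUnit_constSection {U : Opens (Spec M)} {s : M} (hs : ∀ p ∈ U, s ∈ p.primeCompl) :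
    IsUnit (constSection s (op U) : (tildeInType M M).obj.obj (op U)) := by
  let t : (tildeInType M M).obj.obj (op U) := ⟨fun p => OreLocalization.oreDiv 1 ⟨s, hs p.1 p.2⟩,
    fun p => ⟨U, p.2, 𝟙 _, 1, s, fun q => ⟨hs q.1 q.2, rfl⟩⟩⟩
  refine IsUnit.of_mul_eq_one t (Subtype.ext (funext fun p => ?_))
  refine (loc_smul_div (A := M) s 1 ⟨s, hs p.1 p.2⟩).trans ?_
  rw [smul_eq_mul, mul_one]
  exact OreLocalization.div_eq_one (s := (⟨s, hs p.1 p.2⟩ : p.1.primeCompl))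

/-- The sheaves `Ã` are cartesian. -/
theorem tilde_isCartesian (M : Type u) [CommMonoid M] (A : Type u) [MulAction M A] :
    (tilde M A).IsCartesian := by
  intro U V hU hV h
  constructor
  · intro b
    obtain ⟨a, s, hb⟩ := exists_fraction hV b
    refine ⟨constSection s (op U),
      isUnit_constSection (U := V) fun p hp => (hb ⟨p, hp⟩).1,
      (constSection a (op U) : (tildeInType M A).obj.obj (op U)), ?_⟩
    refine Subtype.ext (funext fun p => ?_)
    obtain ⟨hs, hbp⟩ := hb p
    refine (congrArg (fun z : Loc M A p.1 =>
      (OreLocalization.oreDiv s 1 : Loc M M p.1) • z) hbp).trans ?_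
    rw [loc_smul_div]
    exact loc_div_eq_iff.mpr ⟨1, p.1.primeCompl.one_mem, by simp⟩
  · intro σ τ hστ
    obtain ⟨a, s, hσ⟩ := exists_fraction hU σ
    obtain ⟨b, t, hτ⟩ := exists_fraction hU τ
    obtain ⟨q, hq, hqV⟩ := hV
    obtain ⟨hsq, hσq⟩ := hσ ⟨q, h hq⟩
    obtain ⟨htq, hτq⟩ := hτ ⟨q, h hq⟩
    have hq' : (OreLocalization.oreDiv a ⟨s, hsq⟩ : Loc M A q) =
        OreLocalization.oreDiv b ⟨t, htq⟩ :=
      hσq.symm.trans ((congrFun (congrArg Subtype.val hστ) ⟨q, hq⟩).trans hτq)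
    obtain ⟨w, hw, hwab⟩ := loc_div_eq_iff.mp hq'
    refine ⟨constSection w (op U), isUnit_constSection (U := V) fun p hp => hqV (D w) hw hp, ?_⟩
    refine Subtype.ext (funext fun p => ?_)
    obtain ⟨hs, hσp⟩ := hσ p
    obtain ⟨ht, hτp⟩ := hτ p
    refine (congrArg (fun z : Loc M A p.1 =>
      (OreLocalization.oreDiv w 1 : Loc M M p.1) • z) hσp).trans (Eq.trans ?_
      (congrArg (fun z : Loc M A p.1 =>
      (OreLocalization.oreDiv w 1 : Loc M M p.1) • z) hτp).symm)
    rw [loc_smul_div, loc_smul_div, loc_div_eq_iff]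
    exact ⟨1, p.1.primeCompl.one_mem, by rw [smul_comm t w, smul_comm s w, hwab]⟩

theorem isUnit_of_notMem_centre_one {x : M} (h : x ∉ (centre (1 : M)).asIdeal) : IsUnit x := by
  obtain ⟨n, hn⟩ := notMem_centre.mp h
  exact isUnit_of_dvd_one (one_pow (M := M) n ▸ hn)

/-- The global sections of `Ã` are the elements of `A`. -/
theorem constSection_bijective (M : Type u) [CommMonoid M] (A : Type u) [MulAction M A] :
    Function.Bijective
      (fun a : A => (constSection a (op ⊤) : (tildeInType M A).obj.obj (op ⊤))) := by
  constructor
  · intro a b hab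
    obtain ⟨w, hw, hwab⟩ := loc_div_eq_iff.mp
      (congrFun (congrArg Subtype.val hab) ⟨centre (1 : M), trivial⟩)
    exact (isUnit_of_notMem_centre_one hw).smul_left_cancel.mp (by simpa using hwab)
  · intro σ
    obtain ⟨a, s, h⟩ := exists_fraction (U := ⊤) (isLocalOpen_top M) σ
    obtain ⟨c, rfl⟩ : ∃ c : A, s • c = a := by
      obtain ⟨s, rfl⟩ := isUnit_of_notMem_centre_one (h ⟨centre (1 : M), trivial⟩).1
      exact ⟨s⁻¹ • a, smul_inv_smul s a⟩
    refine ⟨c, Subtype.ext (funext fun p => ?_)⟩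
    obtain ⟨hs, hσ⟩ := h p
    refine Eq.trans ?_ hσ.symm
    exact loc_div_eq_iff.mpr ⟨1, p.1.primeCompl.one_mem, by simp⟩

theorem constSection_smul (m : M) (a : A) (U : (Opens (specTop M))ᵒᵖ) :
    constSection (M := M) (m • a) U =
      (constSection m U : (tildeInType M M).obj.obj U) • constSection a U :=
  Subtype.ext (funext fun _ => (loc_smul_div m a 1).symm)

/-- The monoid `M` as the monoid of global sections of the structure sheaf of `Spec M`. -/
def globalSectionsEquiv (M : Type u) [CommMonoid M] :
    M ≃* (Spec M).presheaf.obj (op (⊤ : Opens (Spec M))) :=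
  { Equiv.ofBijective _ (constSection_bijective M M) with
    map_mul' := fun a b => constSection_smul a b _ }

/-- The elements of `A` as the global sections of `Ã`. -/
def tildeGlobalEquiv (M : Type u) [CommMonoid M] (A : Type u) [MulAction M A] :
    A ≃ (tilde M A).Sec ⊤ :=
  Equiv.ofBijective _ (constSection_bijective M A)

theorem tildeGlobalEquiv_smul (m : M) (a : A) :
    tildeGlobalEquiv M A (m • a) = globalSectionsEquiv M m • tildeGlobalEquiv M A a :=
  constSection_smul m a _

/-- The sections of the structure sheaf of an affine monoid scheme over a local open set are a
localisation of the global ones. -/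
theorem struct_spec_isCartesian (M : Type u) [CommMonoid M] : (struct (Spec M)).IsCartesian :=
  fun _ _ hU hV h => ⟨(tilde_isCartesian M M hU hV h).surj, (tilde_isCartesian M M hU hV h).inj⟩

end Tilde

/-! ### Quasi-coherent sheaves on monoid schemes -/

namespace MonoidScheme

open OSet

variable (X : MonoidScheme.{u})

theorem hasLocalBasis : HasLocalBasis X.toSheafedSpace := fun x U hx => by
  obtain ⟨M, f, hf, y, rfl⟩ := X.exists_affine x
  obtain ⟨V, hV, hyV, hVU⟩ := MSpec.hasLocalBasis M y ((Opens.map f.hom.base).obj U) hx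
  refine ⟨im f V, (isLocalOpen_im f).mpr hV, (mem_im f).mpr hyV, ?_⟩
  rintro _ ⟨z, hz, rfl⟩
  exact hVU hz

theorem struct_isCartesian : (struct X.toSheafedSpace).IsCartesian :=
  isCartesian_of_cover fun x => by
    obtain ⟨M, f, hf, hx⟩ := X.exists_affine x
    exact ⟨Spec M, f, hf, hx, (struct_spec_isCartesian M).of_iso (structRestrictIso f)⟩

variable {X}

/-- The restriction of a cartesian sheaf to an affine chart `Spec M` is associated with any `M`-set
isomorphic to the `M`-set of its sections there. -/
theorem exists_iso_tilde {F : OSet X.toSheafedSpace} (hF : F.IsCartesian) {M : Type u}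
    [CommMonoid M] (f : Spec M ⟶ X.toSheafedSpace) [SheafedSpace.IsOpenImmersion f]
    {A : Type u} [MulAction M A] (φ : (F.restrict f).Sec ⊤ ≃ A)
    (hφ : ∀ (m : M) a, φ (globalSectionsEquiv M m • a) = m • φ a) :
    ∃ e : F.restrict f ≅ tilde M A, ∀ a, Hom.on e.hom ⊤ a = tildeSection M (φ a) (op ⊤) := by
  obtain ⟨e, he⟩ := IsCartesian.exists_iso (MSpec.hasLocalBasis M) (MSpec.isLocalOpen_top M)
    (struct_spec_isCartesian M) (hF.restrict f) (tilde_isCartesian M A)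
    (φ.trans (tildeGlobalEquiv M A)) fun m a => by
      obtain ⟨m, rfl⟩ := (globalSectionsEquiv M).surjective m
      exact (congrArg _ (hφ m a)).trans (tildeGlobalEquiv_smul m _)
  exact ⟨e, fun a => congrFun he a⟩

theorem isQuasicoherent_iff_isCartesian {F : OSet X.toSheafedSpace} :
    isQuasicoherent X.toSheafedSpace F ↔ F.IsCartesian := by
  constructor
  · intro hF
    refine isCartesian_of_cover fun x => ?_
    obtain ⟨M, f, hf, hx, A, _, ⟨e⟩⟩ := hF x
    exact ⟨Spec M, f, hf, hx, (tilde_isCartesian M A).of_iso e.symm⟩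
  · intro hF x
    obtain ⟨M, f, hf, hx⟩ := X.exists_affine x
    let _ : MulAction M ((F.restrict f).Sec ⊤) :=
      MulAction.compHom _ (globalSectionsEquiv M).toMonoidHom
    obtain ⟨e, -⟩ := exists_iso_tilde hF f (Equiv.refl ((F.restrict f).Sec ⊤)) fun _ _ => rfl
    exact ⟨M, f, hf, hx, _, _, ⟨e⟩⟩

end MonoidScheme

/-! ### Ideals and localisation -/

section Ideals

variable {M N P : Type*} [CommMonoid M] [CommMonoid N] [CommMonoid P]

/-- The ideal generated by the image of an ideal under a homomorphism. -/
def extIdeal (φ : M →* N) (I : SemigroupIdeal M) : SemigroupIdeal N where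
  carrier := {b | ∃ a ∈ I, φ a ∣ b}
  smul_mem' := fun c _ ⟨a, ha, h⟩ => ⟨a, ha, h.mul_left c⟩

/-- The preimage of an ideal under a homomorphism. -/
def comapIdeal (φ : M →* N) (J : SemigroupIdeal N) : SemigroupIdeal M where
  carrier := {a | φ a ∈ J}
  smul_mem' := fun c x hx => by
    change φ (c * x) ∈ J
    rw [map_mul]
    exact J.smul_mem _ hx

theorem mem_comapIdeal {φ : M →* N} {J : SemigroupIdeal N} {a : M} :
    a ∈ comapIdeal φ J ↔ φ a ∈ J := Iff.rfl

/-- Isomorphic monoids have the same ideals. -/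
def comapIdealEquiv (e : M ≃* N) : SemigroupIdeal N ≃ SemigroupIdeal M where
  toFun := comapIdeal (e : M →* N)
  invFun := comapIdeal (e.symm : N →* M)
  left_inv := fun I => SetLike.ext fun x => by simp [mem_comapIdeal]
  right_inv := fun I => SetLike.ext fun x => by simp [mem_comapIdeal]

theorem mem_colon {I : SemigroupIdeal M} {a x : M} : x ∈ Omega.colon I a ↔ a * x ∈ I := Iff.rfl

theorem mem_ideal_of_dvd {I : SemigroupIdeal M} {a b : M} (h : a ∣ b) (ha : a ∈ I) : b ∈ I := by
  obtain ⟨c, rfl⟩ := h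
  rw [mul_comm]
  exact I.smul_mem c ha

theorem unit_mul_mem_iff {I : SemigroupIdeal M} {u x : M} (hu : IsUnit u) : u * x ∈ I ↔ x ∈ I :=
  ⟨mem_ideal_of_dvd (hu.mul_left_dvd.mpr dvd_rfl), I.smul_mem u⟩

theorem extIdeal_extIdeal (φ : M →* N) (ψ : N →* P) (I : SemigroupIdeal M) :
    extIdeal ψ (extIdeal φ I) = extIdeal (ψ.comp φ) I :=
  SetLike.ext fun b => by
    constructor
    · rintro ⟨_, ⟨a, ha, hab⟩, hb⟩
      exact ⟨a, ha, (map_dvd ψ hab).trans hb⟩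
    · rintro ⟨a, ha, h⟩
      exact ⟨φ a, ⟨a, ha, dvd_rfl⟩, h⟩

theorem extIdeal_id (I : SemigroupIdeal M) : extIdeal (MonoidHom.id M) I = I :=
  SetLike.ext fun b => by
    constructor
    · rintro ⟨_, ha, h⟩
      exact mem_ideal_of_dvd h ha
    · exact fun h => ⟨b, h, dvd_rfl⟩

theorem extIdeal_top (φ : M →* N) : extIdeal φ ⊤ = ⊤ :=
  top_le_iff.mp fun _ _ => ⟨1, trivial, by rw [map_one]; exact one_dvd _⟩

/-- A homomorphism `φ : M →* N` that makes `N` the localisation of `M` at the elements whose image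
is invertible. -/
structure IsLocalizationHom (φ : M →* N) : Prop where
  surj : ∀ b : N, ∃ s : M, IsUnit (φ s) ∧ ∃ a : M, φ s * b = φ a
  inj : ∀ a a' : M, φ a = φ a' → ∃ s : M, IsUnit (φ s) ∧ s * a = s * a'

namespace IsLocalizationHom

variable {φ : M →* N} (hφ : IsLocalizationHom φ)
include hφ

theorem ideal_ext {J J' : SemigroupIdeal N} (h : ∀ a, φ a ∈ J ↔ φ a ∈ J') : J = J' :=
  SetLike.ext fun b => by
    obtain ⟨s, hs, a, ha⟩ := hφ.surj b
    rw [← unit_mul_mem_iff hs, ha, h, ← ha, unit_mul_mem_iff hs]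

theorem map_mem_extIdeal_iff {I : SemigroupIdeal M} {x : M} :
    φ x ∈ extIdeal φ I ↔ ∃ s, IsUnit (φ s) ∧ s * x ∈ I := by
  constructor
  · rintro ⟨a, ha, c, hc⟩
    obtain ⟨t, ht, d, hd⟩ := hφ.surj c
    obtain ⟨w, hw, h⟩ := hφ.inj (t * x) (d * a) (by
      rw [map_mul, map_mul, hc, ← hd, mul_left_comm, mul_comm])
    refine ⟨w * t, by rw [map_mul]; exact hw.mul ht, ?_⟩
    rw [mul_assoc, h]
    exact I.smul_mem w (I.smul_mem d ha)
  · rintro ⟨s, hs, h⟩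
    refine (unit_mul_mem_iff hs).mp ⟨s * x, h, ?_⟩
    rw [map_mul]

theorem extIdeal_comapIdeal (J : SemigroupIdeal N) : extIdeal φ (comapIdeal φ J) = J :=
  hφ.ideal_ext fun a => ⟨fun ⟨_, hx, h⟩ => mem_ideal_of_dvd h hx, fun h => ⟨a, h, dvd_rfl⟩⟩

theorem extIdeal_colon (I : SemigroupIdeal M) (m : M) :
    extIdeal φ (Omega.colon I m) = Omega.colon (extIdeal φ I) (φ m) :=
  hφ.ideal_ext fun a => by
    rw [hφ.map_mem_extIdeal_iff, mem_colon, ← map_mul, hφ.map_mem_extIdeal_iff]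
    simp only [mem_colon, mul_left_comm m]

theorem isSNoetherian (hM : IsSNoetherianMonoid M) : IsSNoetherianMonoid N := by
  have : WellFoundedGT (SemigroupIdeal M) := hM
  refine StrictMono.wellFoundedGT (f := comapIdeal φ) (Monotone.strictMono_of_injective
    (fun J J' h a ha => h ha) fun J J' h => ?_)
  rw [← hφ.extIdeal_comapIdeal J, h, hφ.extIdeal_comapIdeal]

/-- Over an `s`-Noetherian monoid, the saturation of an ideal is reached by one denominator. -/
theorem exists_colon_eq (hM : IsSNoetherianMonoid M) (I : SemigroupIdeal M) :
    ∃ s, IsUnit (φ s) ∧ Omega.colon I s = comapIdeal φ (extIdeal φ I) := by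
  have : WellFoundedGT (SemigroupIdeal M) := hM
  obtain ⟨_, ⟨s, hs, rfl⟩, hmax⟩ := wellFounded_gt.has_min
    {K : SemigroupIdeal M | ∃ s, IsUnit (φ s) ∧ Omega.colon I s = K} ⟨_, 1, by simp, rfl⟩
  refine ⟨s, hs, SetLike.ext fun x => ?_⟩
  rw [mem_comapIdeal, hφ.map_mem_extIdeal_iff]
  constructor
  · exact fun hx => ⟨s, hs, hx⟩
  · rintro ⟨t, ht, hx⟩
    have hle : Omega.colon I s ≤ Omega.colon I (s * t) := fun y hy => by
      rw [mem_colon] at hy ⊢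
      rw [mul_right_comm, mul_comm]
      exact I.smul_mem t hy
    have heq : Omega.colon I s = Omega.colon I (s * t) := by
      by_contra hne
      exact hmax _ ⟨s * t, by rw [map_mul]; exact hs.mul ht, rfl⟩ (lt_of_le_of_ne hle hne)
    rw [heq, mem_colon, mul_assoc]
    exact I.smul_mem s hx

theorem exists_colon_eq_colon (hM : IsSNoetherianMonoid M) {I I' : SemigroupIdeal M}
    (h : extIdeal φ I = extIdeal φ I') :
    ∃ s, IsUnit (φ s) ∧ Omega.colon I s = Omega.colon I' s := by
  -- the saturations `(I : s)` and `(I' : t)` agree, and forming quotients by `t` and by `s` does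
  -- not change them
  obtain ⟨s, hs, hI⟩ := hφ.exists_colon_eq hM I
  obtain ⟨t, ht, hI'⟩ := hφ.exists_colon_eq hM I'
  have hsat : ∀ {u}, IsUnit (φ u) → ∀ J : SemigroupIdeal N,
      Omega.colon (comapIdeal φ J) u = comapIdeal φ J := fun hu J => SetLike.ext fun x => by
    rw [mem_colon, mem_comapIdeal, mem_comapIdeal, map_mul, unit_mul_mem_iff hu]
  refine ⟨s * t, by rw [map_mul]; exact hs.mul ht, ?_⟩
  rw [Omega.colon_mul I' s t, hI', hsat hs, mul_comm, Omega.colon_mul I t s, hI, hsat ht, h]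

end IsLocalizationHom

theorem isSNoetherian_of_mulEquiv (e : M ≃* N) (hM : IsSNoetherianMonoid M) :
    IsSNoetherianMonoid N :=
  IsLocalizationHom.isSNoetherian (φ := (e : M →* N))
    ⟨fun b => ⟨1, by simp, e.symm b, by simp⟩, fun a a' h => ⟨1, by simp, by simpa using h⟩⟩ hM

end Ideals

namespace OSet

variable {X : SheafedSpace.{u + 1, u, u} CommMonCat.{u}}

theorem IsCartesian.isLocalizationHom (hO : (struct X).IsCartesian) {U V : Opens X}
    (hU : IsLocalOpen U) (hV : IsLocalOpen V) (h : V ≤ U) : IsLocalizationHom (ores X h) :=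
  ⟨(hO hU hV h).surj, (hO hU hV h).inj⟩

/-! ### Fibre products of cartesian sheaves -/

/-- The final sheaf. -/
def one (X : SheafedSpace.{u + 1, u, u} CommMonCat.{u}) : OSet X where
  presheaf := (Functor.const _).obj PUnit
  isSheaf := TopCat.Presheaf.isSheaf_of_isSheafUniqueGluing_types _ fun _ _ _ _ =>
    ⟨PUnit.unit, fun _ => rfl, fun _ _ => rfl⟩
  mulAction _ :=
    { smul := fun _ a => a
      one_smul := fun _ => rfl
      mul_smul := fun _ _ _ => rfl }
  map_smul _ _ _ := rfl

theorem one_isCartesian : (one X).IsCartesian := fun _ _ _ _ _ =>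
  ⟨fun _ => ⟨1, by simp, PUnit.unit, rfl⟩, fun _ _ _ => ⟨1, by simp, rfl⟩⟩

/-- The morphism to the final sheaf. -/
def toOne (F : OSet X) : F ⟶ one X :=
  homMk (fun _ _ => PUnit.unit) (fun _ _ _ => rfl) (fun _ _ => rfl)

theorem hom_one_ext {F : OSet X} (φ ψ : F ⟶ one X) : φ = ψ := Hom.ext_on fun _ _ => rfl

variable {F G H : OSet X}

/-- Compatible sections over a cover can be glued. -/
theorem exists_glue (F : OSet X) {ι : Type u} (U : ι → Opens X) {V : Opens X}
    (hU : ∀ i, U i ≤ V) (hV : V ≤ iSup U) (a : ∀ i, F.Sec (U i))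
    (h : ∀ i j, F.res inf_le_left (a i) = (F.res inf_le_right (a j) : F.Sec (U i ⊓ U j))) :
    ∃ b : F.Sec V, ∀ i, F.res (hU i) b = a i := by
  have h' : TopCat.Presheaf.IsCompatible F.presheaf U a := h
  exact (F.toSheaf.existsUnique_gluing' U V (fun i => homOfLE (hU i)) hV a h').exists

/-- The sections of a fibre product. -/
abbrev FibreSec (φ : F ⟶ H) (ψ : G ⟶ H) (U : Opens X) : Type u :=
  {p : F.Sec U × G.Sec U // Hom.on φ U p.1 = Hom.on ψ U p.2}

theorem FibreSec.ext {φ : F ⟶ H} {ψ : G ⟶ H} {U : Opens X} {p q : FibreSec φ ψ U}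
    (h : p.1.1 = q.1.1) (h' : p.1.2 = q.1.2) : p = q :=
  Subtype.ext (Prod.ext h h')

/-- Restriction of sections of a fibre product. -/
def FibreSec.res {φ : F ⟶ H} {ψ : G ⟶ H} {U V : Opens X} (h : V ≤ U) (p : FibreSec φ ψ U) :
    FibreSec φ ψ V :=
  ⟨(F.res h p.1.1, G.res h p.1.2), by rw [Hom.on_res, Hom.on_res, p.2]⟩

theorem FibreSec.res_self {φ : F ⟶ H} {ψ : G ⟶ H} {U : Opens X} (p : FibreSec φ ψ U) :
    p.res le_rfl = p :=
  FibreSec.ext (F.res_self _) (G.res_self _)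

theorem FibreSec.res_res {φ : F ⟶ H} {ψ : G ⟶ H} {U V W : Opens X} (h : V ≤ U) (h' : W ≤ V)
    (p : FibreSec φ ψ U) : (p.res h).res h' = p.res (h'.trans h) :=
  FibreSec.ext (F.res_res _ _ _) (G.res_res _ _ _)

/-- The fibre product of sheaves of `𝒪_X`-sets: its sections are the pairs of sections with the same
image. -/
def fibre (φ : F ⟶ H) (ψ : G ⟶ H) : OSet X where
  presheaf :=
    { obj := fun U => FibreSec φ ψ (unop U)
      map := fun i => TypeCat.ofHom (FibreSec.res (leOfHom i.unop))
      map_id := fun U => ConcreteCategory.hom_ext _ _ fun p => FibreSec.res_self p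
      map_comp := fun i j => ConcreteCategory.hom_ext _ _ fun p =>
        (FibreSec.res_res (leOfHom i.unop) (leOfHom j.unop) p).symm }
  isSheaf := TopCat.Presheaf.isSheaf_of_isSheafUniqueGluing_types _ fun ι U sf hsf => by
    obtain ⟨a, ha⟩ := F.exists_glue U (le_iSup U) le_rfl (fun i => (sf i).1.1)
      fun i j => congrArg (fun p => p.1.1) (hsf i j)
    obtain ⟨b, hb⟩ := G.exists_glue U (le_iSup U) le_rfl (fun i => (sf i).1.2)
      fun i j => congrArg (fun p => p.1.2) (hsf i j)
    refine ⟨⟨(a, b), H.eq_of_locally_eq _ _ fun x hx => ?_⟩,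
      fun i => FibreSec.ext (ha i) (hb i), fun p hp => FibreSec.ext ?_ ?_⟩
    · obtain ⟨i, hi⟩ := Opens.mem_iSup.mp hx
      exact ⟨U i, le_iSup U i, hi, by rw [← Hom.on_res, ← Hom.on_res, ha, hb, (sf i).2]⟩
    · refine F.eq_of_locally_eq _ _ fun x hx => ?_
      obtain ⟨i, hi⟩ := Opens.mem_iSup.mp hx
      exact ⟨U i, le_iSup U i, hi, (congrArg (fun p => p.1.1) (hp i)).trans (ha i).symm⟩
    · refine G.eq_of_locally_eq _ _ fun x hx => ?_
      obtain ⟨i, hi⟩ := Opens.mem_iSup.mp hx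
      exact ⟨U i, le_iSup U i, hi, (congrArg (fun p => p.1.2) (hp i)).trans (hb i).symm⟩
  mulAction U :=
    { smul := fun m p => ⟨(m • p.1.1, m • p.1.2), by
        have := p.2
        rw [Hom.on_smul (U := unop U), Hom.on_smul (U := unop U), this]⟩
      one_smul := fun p => FibreSec.ext (one_smul (X.presheaf.obj U) p.1.1)
        (one_smul (X.presheaf.obj U) p.1.2)
      mul_smul := fun m n p => FibreSec.ext (mul_smul m n p.1.1) (mul_smul m n p.1.2) }
  map_smul i m p := FibreSec.ext (F.map_smul i m p.1.1) (G.map_smul i m p.1.2)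

/-- The first projection of a fibre product. -/
def fibreFst (φ : F ⟶ H) (ψ : G ⟶ H) : fibre φ ψ ⟶ F :=
  homMk (fun U (p : FibreSec φ ψ U) => p.1.1) (fun _ _ _ => rfl) (fun _ _ => rfl)

/-- The second projection of a fibre product. -/
def fibreSnd (φ : F ⟶ H) (ψ : G ⟶ H) : fibre φ ψ ⟶ G :=
  homMk (fun U (p : FibreSec φ ψ U) => p.1.2) (fun _ _ _ => rfl) (fun _ _ => rfl)

theorem fibre_condition (φ : F ⟶ H) (ψ : G ⟶ H) : fibreFst φ ψ ≫ φ = fibreSnd φ ψ ≫ ψ :=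
  Hom.ext_on fun U (p : FibreSec φ ψ U) => p.2

/-- Localisation commutes with fibre products. -/
theorem fibre_isCartesian (hF : F.IsCartesian) (hG : G.IsCartesian) (hH : H.IsCartesian)
    (φ : F ⟶ H) (ψ : G ⟶ H) : (fibre φ ψ).IsCartesian := by
  intro U V hU hV h
  constructor
  · rintro (⟨⟨b, c⟩, hbc⟩ : FibreSec φ ψ V)
    obtain ⟨s, hs, a, ha⟩ := (hF hU hV h).surj b
    obtain ⟨t, ht, d, hd⟩ := (hG hU hV h).surj c
    obtain ⟨w, hw, hwe⟩ := (hH hU hV h).inj (Hom.on φ U (t • a)) (Hom.on ψ U (s • d)) (by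
      rw [← Hom.on_res, ← Hom.on_res, F.res_smul, G.res_smul, ← ha, ← hd, smul_smul, smul_smul,
        Hom.on_smul, Hom.on_smul, mul_comm]
      exact congrArg _ hbc)
    refine ⟨w * (s * t), ?_, ⟨(w • t • a, w • s • d), ?_⟩, FibreSec.ext ?_ ?_⟩
    · rw [map_mul, map_mul]
      exact hw.mul (hs.mul ht)
    · exact (Hom.on_smul φ w _).trans (hwe.trans (Hom.on_smul ψ w _).symm)
    · change ores X h (w * (s * t)) • b = F.res h (w • t • a)
      rw [F.res_smul, F.res_smul, ← ha, smul_smul, smul_smul, map_mul, map_mul,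
        mul_comm (ores X h s), mul_assoc]
    · change ores X h (w * (s * t)) • c = G.res h (w • s • d)
      rw [G.res_smul, G.res_smul, ← hd, smul_smul, smul_smul, map_mul, map_mul, mul_assoc]
  · rintro (⟨⟨a, b⟩, hab⟩ : FibreSec φ ψ U) (⟨⟨a', b'⟩, hab'⟩ : FibreSec φ ψ U) he
    obtain ⟨s, hs, hsa⟩ := (hF hU hV h).inj a a' (congrArg (fun p : FibreSec φ ψ V => p.1.1) he)
    obtain ⟨t, ht, htb⟩ := (hG hU hV h).inj b b' (congrArg (fun p : FibreSec φ ψ V => p.1.2) he)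
    refine ⟨s * t, by rw [map_mul]; exact hs.mul ht, FibreSec.ext ?_ ?_⟩
    · change (s * t) • a = (s * t) • a'
      rw [mul_comm, mul_smul, hsa, mul_smul]
    · change (s * t) • b = (s * t) • b'
      rw [mul_smul, htb, mul_smul]

/-- For a morphism that is injective on sections, being in the image is a local property. -/
theorem exists_on_eq_of_local (hX : HasLocalBasis X) {φ : F ⟶ G}
    (hφ : ∀ U, Function.Injective (Hom.on φ U)) {U : Opens X} (g : G.Sec U)
    (h : ∀ V (hV : V ≤ U), IsLocalOpen V → ∃ a, Hom.on φ V a = G.res hV g) :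
    ∃ a, Hom.on φ U a = g := by
  choose a ha using h
  let ι := {V : Opens X // V ≤ U ∧ IsLocalOpen V}
  obtain ⟨b, hb⟩ := F.exists_glue (fun i : ι => i.1) (V := U) (fun i => i.2.1) (fun x hx => by
      obtain ⟨V, hV, hxV, hVU⟩ := hX x U hx
      exact Opens.mem_iSup.mpr ⟨⟨V, hVU, hV⟩, hxV⟩) (fun i => a i.1 i.2.1 i.2.2) (fun i j => by
      apply hφ
      rw [Hom.on_res, Hom.on_res, ha, ha, G.res_res, G.res_res])
  exact ⟨b, G.eq_of_eq_local hX _ _ fun V hVU hV => by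
    rw [← Hom.on_res, hb ⟨V, hVU, hV⟩, ha]⟩

end OSet

namespace MonoidScheme

open OSet

variable (X : MonoidScheme.{u})

/-! ### The sheaf of ideals -/

/-- The sections over `U` of the sheaf `Ω^X`: families of ideals of the monoids `𝒪_X(V)`, for the
local open sets `V ⊆ U`, that are compatible with extension of ideals. -/
@[ext]
structure IdealFamily (U : Opens X.toSheafedSpace) where
  ideal : ∀ V : Opens X.toSheafedSpace, IsLocalOpen V → V ≤ U →
    SemigroupIdeal (X.presheaf.obj (op V))
  ext_ideal : ∀ {V W : Opens X.toSheafedSpace} (hV : IsLocalOpen V) (hVU : V ≤ U)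
    (hW : IsLocalOpen W) (hWV : W ≤ V),
    extIdeal (ores X.toSheafedSpace hWV) (ideal V hV hVU) = ideal W hW (hWV.trans hVU)

variable {X}

theorem isLocalizationHom_ores {U V : Opens X.toSheafedSpace}
    (hU : IsLocalOpen U) (hV : IsLocalOpen V) (h : V ≤ U) :
    IsLocalizationHom (ores X.toSheafedSpace h) :=
  X.struct_isCartesian.isLocalizationHom hU hV h

namespace IdealFamily

variable {U V : Opens X.toSheafedSpace}

/-- Restriction of families of ideals. -/
def res (h : V ≤ U) (J : X.IdealFamily U) : X.IdealFamily V where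
  ideal W hW hWV := J.ideal W hW (hWV.trans h)
  ext_ideal hW hWV hW' h' := J.ext_ideal hW (hWV.trans h) hW' h'

/-- The action `m • J = (J : m)` on families of ideals. -/
def smul (m : X.presheaf.obj (op U)) (J : X.IdealFamily U) : X.IdealFamily U where
  ideal V hV hVU := Omega.colon (J.ideal V hV hVU) (ores X.toSheafedSpace hVU m)
  ext_ideal hV hVU hW h := by
    rw [(isLocalizationHom_ores hV hW h).extIdeal_colon, J.ext_ideal, ores_ores]

/-- The family of unit ideals. -/
def top (U : Opens X.toSheafedSpace) : X.IdealFamily U where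
  ideal _ _ _ := ⊤
  ext_ideal _ _ _ _ := extIdeal_top _

/-- Over a local open set `U`, a family of ideals is the same as an ideal of `𝒪_X(U)`. -/
def equivIdeal (hU : IsLocalOpen U) :
    X.IdealFamily U ≃ SemigroupIdeal (X.presheaf.obj (op U)) where
  toFun J := J.ideal U hU le_rfl
  invFun I :=
    { ideal := fun V _ hVU => extIdeal (ores X.toSheafedSpace hVU) I
      ext_ideal := fun _ hVU _ hWV => by
        rw [extIdeal_extIdeal]
        congr 1
        exact MonoidHom.ext fun m => ores_ores hVU hWV m }
  left_inv J := IdealFamily.ext (funext fun V => funext fun hV => funext fun hVU =>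
    J.ext_ideal hU le_rfl hV hVU)
  right_inv I := by
    have : ores X.toSheafedSpace (le_refl U) = MonoidHom.id _ := MonoidHom.ext fun m => ores_self m
    change extIdeal (ores X.toSheafedSpace (le_refl U)) I = I
    rw [this, extIdeal_id]

end IdealFamily

variable (X) in
/-- The sheaf `Ω^X` of families of ideals. -/
def omega : OSet X.toSheafedSpace where
  presheaf :=
    { obj := fun U => X.IdealFamily (unop U)
      map := fun i => TypeCat.ofHom (IdealFamily.res (leOfHom i.unop))
      map_id := fun _ => rfl
      map_comp := fun _ _ => rfl }
  isSheaf := TopCat.Presheaf.isSheaf_of_isSheafUniqueGluing_types _ fun ι U sf hsf => by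
    -- a local open set lies in a member of the cover, which gives the ideal there
    have hex : ∀ V : Opens X.toSheafedSpace, IsLocalOpen V → V ≤ iSup U → ∃ i, V ≤ U i := by
      rintro V ⟨x, hx, hV⟩ hVU
      obtain ⟨i, hi⟩ := Opens.mem_iSup.mp (hVU hx)
      exact ⟨i, hV _ hi⟩
    choose i hi using hex
    let J : ∀ i, X.IdealFamily (U i) := sf
    have hJ : ∀ i j V (hV : IsLocalOpen V) (hVi : V ≤ U i) (hVj : V ≤ U j),
        (J i).ideal V hV hVi = (J j).ideal V hV hVj := fun i j V hV hVi hVj =>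
      congrArg (fun K : X.IdealFamily (U i ⊓ U j) => K.ideal V hV (le_inf hVi hVj)) (hsf i j)
    refine ⟨(⟨fun V hV hVU => (J (i V hV hVU)).ideal V hV (hi V hV hVU),
      fun {V W} hV hVU hW h => ?_⟩ : X.IdealFamily (iSup U)), fun j => ?_, fun K hK => ?_⟩
    · rw [(J _).ext_ideal hV _ hW h]
      exact hJ _ _ _ _ _ _
    · exact IdealFamily.ext (funext fun V => funext fun hV => funext fun hVU => hJ _ _ _ _ _ _)
    · refine IdealFamily.ext (funext fun V => funext fun hV => funext fun hVU => ?_)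
      exact congrArg (fun K : X.IdealFamily (U _) => K.ideal V hV (hi V hV hVU)) (hK (i V hV hVU))
  mulAction U :=
    { smul := IdealFamily.smul
      one_smul := fun J => IdealFamily.ext (funext fun V => funext fun hV => funext fun hVU => by
        change Omega.colon _ (ores X.toSheafedSpace hVU 1) = _
        rw [map_one, Omega.colon_one])
      mul_smul := fun m n J => IdealFamily.ext
        (funext fun V => funext fun hV => funext fun hVU => by
          change Omega.colon _ (ores X.toSheafedSpace hVU (m * n)) = _
          rw [map_mul, Omega.colon_mul]
          rfl) }
  map_smul i m J := IdealFamily.ext (funext fun V => funext fun hV => funext fun hVU =>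
    congrArg (Omega.colon _) (ores_ores (leOfHom i.unop) hVU m).symm)

/-- On an `s`-Noetherian monoid scheme, the monoids of sections over local open sets are
`s`-Noetherian. -/
theorem IsSNoetherian.sections (hX : X.IsSNoetherian) {U : Opens X.toSheafedSpace}
    (hU : IsLocalOpen U) : IsSNoetherianMonoid (X.presheaf.obj (op U)) := by
  obtain ⟨n, M, f, hM, hf, hcov⟩ := hX
  obtain ⟨x, -, hx⟩ := id hU
  obtain ⟨i, y, rfl⟩ := hcov x
  have := hf i
  have hle : U ≤ im (f i) ⊤ := hx _ ((mem_im (f i)).mpr trivial)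
  refine (isLocalizationHom_ores ((isLocalOpen_im (f i)).mpr (MSpec.isLocalOpen_top (M i))) hU
    hle).isSNoetherian ?_
  exact isSNoetherian_of_mulEquiv ((globalSectionsEquiv (M i)).trans (imEquiv (f i) ⊤)) (hM i)

theorem IsSNoetherian.omega_isCartesian (hX : X.IsSNoetherian) : X.omega.IsCartesian := by
  intro U V hU hV h
  have hloc := isLocalizationHom_ores hU hV h
  constructor
  · intro (J : X.IdealFamily V)
    refine ⟨1, by simp, (IdealFamily.equivIdeal hU).symm
      (comapIdeal (ores X.toSheafedSpace h) (IdealFamily.equivIdeal hV J)), ?_⟩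
    rw [map_one]
    refine (one_smul (X.presheaf.obj (op V)) (show X.omega.Sec V from J)).trans ?_
    exact (IdealFamily.equivIdeal hV).injective (hloc.extIdeal_comapIdeal _).symm
  · intro (J : X.IdealFamily U) (J' : X.IdealFamily U) hJ
    obtain ⟨s, hs, h⟩ := hloc.exists_colon_eq_colon (hX.sections hU)
      (I := IdealFamily.equivIdeal hU J) (I' := IdealFamily.equivIdeal hU J')
      ((J.ext_ideal hU le_rfl hV h).trans (Eq.trans
        (congrArg (IdealFamily.equivIdeal hV) hJ) (J'.ext_ideal hU le_rfl hV h).symm))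
    refine ⟨s, hs, (IdealFamily.equivIdeal hU).injective ?_⟩
    change Omega.colon _ (ores X.toSheafedSpace le_rfl s) =
      Omega.colon _ (ores X.toSheafedSpace le_rfl s)
    rw [ores_self]
    exact h

/-! ### Characteristic morphisms -/

variable (X) in
/-- The truth morphism: the family of unit ideals. -/
def truth : one X.toSheafedSpace ⟶ X.omega :=
  homMk (F := one X.toSheafedSpace) (G := X.omega) (fun U _ => IdealFamily.top U)
    (fun _ _ _ => rfl) (fun _ _ => rfl)

variable {F G : OSet X.toSheafedSpace}

/-- The characteristic morphism of a morphism `m : F ⟶ G` of cartesian sheaves: it sends a section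
`g` to the family of the ideals `{a | a • g lies in the image of m}`. -/
def char (hF : F.IsCartesian) (hG : G.IsCartesian) (m : F ⟶ G) : G ⟶ X.omega :=
  homMk (F := G) (G := X.omega)
    (fun U g =>
      { ideal := fun V _ hVU =>
          { carrier := {a | ∃ f, Hom.on m V f = a • G.res hVU g}
            smul_mem' := fun c a ⟨f, hf⟩ => ⟨c • f, by
              rw [Hom.on_smul, hf, smul_smul, smul_eq_mul]⟩ }
        ext_ideal := fun {V W} hV hVU hW h => by
          refine (isLocalizationHom_ores hV hW h).ideal_ext fun a => ?_
          rw [(isLocalizationHom_ores hV hW h).map_mem_extIdeal_iff]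
          constructor
          · rintro ⟨s, hs, f, hf⟩
            obtain ⟨f', hf'⟩ := exists_smul_eq_of_isUnit hs (F.res h f)
            refine ⟨f', smul_left_cancel_of_isUnit hs ?_⟩
            rw [← Hom.on_smul, hf', Hom.on_res, hf, G.res_smul, G.res_res, map_mul, mul_smul]
          · rintro ⟨f, hf⟩
            obtain ⟨s, hs, f', hf'⟩ := (hF hV hW h).surj f
            obtain ⟨t, ht, htf⟩ := (hG hV hW h).inj (Hom.on m V f') (s • a • G.res hVU g) (by
              rw [← Hom.on_res, ← hf', Hom.on_smul, hf, G.res_smul, G.res_smul, G.res_res])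
            refine ⟨t * s, by rw [map_mul]; exact ht.mul hs, t • f', ?_⟩
            rw [Hom.on_smul, htf, smul_smul, smul_smul, mul_assoc] })
    (fun U n g => IdealFamily.ext (funext fun V => funext fun hV => funext fun hVU =>
      SetLike.ext fun a => exists_congr fun f => by
        rw [G.res_smul, smul_smul, mul_comm]))
    (fun h g => IdealFamily.ext (funext fun V => funext fun hV => funext fun hVU =>
      SetLike.ext fun a => exists_congr fun f => by
        rw [G.res_res]))

theorem mem_char {hF : F.IsCartesian} {hG : G.IsCartesian} {m : F ⟶ G}
    {U V : Opens X.toSheafedSpace} {g : G.Sec U} {hV : IsLocalOpen V} {hVU : V ≤ U}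
    {a : X.presheaf.obj (op V)} :
    a ∈ (Hom.on (char hF hG m) U g : X.IdealFamily U).ideal V hV hVU ↔
      ∃ f, Hom.on m V f = a • G.res hVU g := Iff.rfl

theorem char_eq_top_iff (hF : F.IsCartesian) (hG : G.IsCartesian) {m : F ⟶ G}
    (hm : ∀ U, Function.Injective (Hom.on m U)) {U : Opens X.toSheafedSpace} {g : G.Sec U} :
    Hom.on (char hF hG m) U g = (IdealFamily.top U : X.IdealFamily U) ↔
      ∃ f, Hom.on m U f = g := by
  constructor
  · intro h
    refine exists_on_eq_of_local X.hasLocalBasis hm g fun V hVU hV => ?_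
    have h1 : (1 : X.presheaf.obj (op V)) ∈
        (Hom.on (char hF hG m) U g : X.IdealFamily U).ideal V hV hVU := by
      rw [h]
      trivial
    obtain ⟨f, hf⟩ := mem_char.mp h1
    exact ⟨f, by rw [hf, one_smul]⟩
  · rintro ⟨f, rfl⟩
    exact IdealFamily.ext (funext fun V => funext fun hV => funext fun hVU =>
      top_le_iff.mp fun a _ => mem_char.mpr
        ⟨a • F.res hVU f, by rw [Hom.on_smul, Hom.on_res]⟩)

/-- A morphism to `Ω^X` is determined by the sections that it sends to the truth value. -/
theorem hom_omega_ext {φ ψ : G ⟶ X.omega}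
    (h : ∀ U (g : G.Sec U), Hom.on φ U g = (IdealFamily.top U : X.IdealFamily U) ↔
      Hom.on ψ U g = (IdealFamily.top U : X.IdealFamily U)) : φ = ψ := by
  -- over a local open set, `a` lies in the ideal `φ g` if and only if `φ (a • g) = (φ g : a)` is
  -- the unit ideal
  have key : ∀ (χ : G ⟶ X.omega) (U) (hU : IsLocalOpen U) (g : G.Sec U) (a : X.presheaf.obj (op U)),
      Hom.on χ U (a • g) = (IdealFamily.top U : X.IdealFamily U) ↔
        a ∈ (Hom.on χ U g : X.IdealFamily U).ideal U hU le_rfl := by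
    intro χ U hU g a
    refine (IdealFamily.equivIdeal hU).injective.eq_iff.symm.trans ?_
    rw [Hom.on_smul]
    change Omega.colon _ (ores X.toSheafedSpace le_rfl a) = ⊤ ↔ _
    rw [ores_self]
    constructor
    · intro h
      have : (1 : X.presheaf.obj (op U)) ∈ Omega.colon
        ((Hom.on χ U g : X.IdealFamily U).ideal U hU le_rfl) a := h ▸ trivial
      rwa [mem_colon, mul_one] at this
    · exact fun h => top_le_iff.mp fun x _ =>
        mem_colon.mpr (mem_ideal_of_dvd (dvd_mul_right a x) h)
  refine Hom.ext_local X.hasLocalBasis fun U hU g => (IdealFamily.equivIdeal hU).injective ?_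
  refine SetLike.ext fun a => ?_
  exact (key φ U hU g a).symm.trans ((h U _).trans (key ψ U hU g a))

/-! ### The subobject classifier -/

section Qc

/-- The object of `Qc(X)` given by a cartesian sheaf. -/
abbrev qcMk (F : OSet X.toSheafedSpace) (hF : F.IsCartesian) : Qc X :=
  ⟨F, isQuasicoherent_iff_isCartesian.mpr hF⟩

theorem qc_isCartesian (F : Qc X) : F.obj.IsCartesian :=
  isQuasicoherent_iff_isCartesian.mp F.property

/-- The fibre product in `Qc(X)`. -/
abbrev qcFibre {A B C : Qc X} (φ : A ⟶ C) (ψ : B ⟶ C) : Qc X :=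
  qcMk (fibre φ.hom ψ.hom) (fibre_isCartesian (qc_isCartesian A) (qc_isCartesian B)
    (qc_isCartesian C) φ.hom ψ.hom)

/-- Monomorphisms of quasi-coherent sheaves are injective on sections: the two projections of
the kernel pair, which is quasi-coherent, agree. -/
theorem injective_of_mono {A B : Qc X} (m : A ⟶ B) [Mono m] (U : Opens X.toSheafedSpace) :
    Function.Injective (Hom.on m.hom U) := by
  intro a a' h
  let p : qcFibre m m ⟶ A := ObjectProperty.homMk (fibreFst m.hom m.hom)
  let q : qcFibre m m ⟶ A := ObjectProperty.homMk (fibreSnd m.hom m.hom)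
  have hpq : p = q := (cancel_mono m).mp
    (ObjectProperty.hom_ext _ (fibre_condition m.hom m.hom))
  exact congrArg (fun r : qcFibre m m ⟶ A => Hom.on r.hom U
    (⟨(a, a'), h⟩ : FibreSec m.hom m.hom U)) hpq

/-- In a pullback square of quasi-coherent sheaves, sections of the lower left and upper right
corners with the same image come from a section of the upper left corner. -/
theorem exists_of_isPullback {P A B C : Qc X} {p : P ⟶ A} {q : P ⟶ B} {φ : A ⟶ C} {ψ : B ⟶ C}
    (h : IsPullback p q φ ψ) (U : Opens X.toSheafedSpace) (a : A.obj.Sec U) (b : B.obj.Sec U)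
    (hab : Hom.on φ.hom U a = Hom.on ψ.hom U b) : ∃ x, Hom.on p.hom U x = a := by
  let p' : qcFibre φ ψ ⟶ A := ObjectProperty.homMk (fibreFst φ.hom ψ.hom)
  let q' : qcFibre φ ψ ⟶ B := ObjectProperty.homMk (fibreSnd φ.hom ψ.hom)
  have w : p' ≫ φ = q' ≫ ψ := ObjectProperty.hom_ext _ (fibre_condition φ.hom ψ.hom)
  let z : FibreSec φ.hom ψ.hom U := ⟨(a, b), hab⟩
  exact ⟨Hom.on (h.lift p' q' w).hom U z,
    congrArg (fun r : qcFibre φ ψ ⟶ A => Hom.on r.hom U z) (h.lift_fst p' q' w)⟩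

variable (X) in
/-- The final object of `Qc(X)`. -/
abbrev qcOne : Qc X := qcMk (one X.toSheafedSpace) one_isCartesian

variable (X) in
/-- The sheaf `1` is final in `Qc(X)`. -/
def qcOneIsTerminal : Limits.IsTerminal (qcOne X) :=
  Limits.IsTerminal.ofUniqueHom (fun F => ObjectProperty.homMk (toOne F.obj))
    fun _ _ => ObjectProperty.hom_ext _ (hom_one_ext _ _)

variable (hX : X.IsSNoetherian) {A B : Qc X} (m : A ⟶ B)

/-- The object `Ω^X` of `Qc(X)`. -/
abbrev qcOmega : Qc X := qcMk X.omega hX.omega_isCartesian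

/-- The truth morphism in `Qc(X)`. -/
abbrev qcTruth : qcOne X ⟶ qcOmega hX := ObjectProperty.homMk X.truth

/-- The characteristic morphism of `m` in `Qc(X)`. -/
abbrev qcChar : B ⟶ qcOmega hX :=
  ObjectProperty.homMk (char (qc_isCartesian A) (qc_isCartesian B) m.hom)

theorem qcChar_eq_top_iff [Mono m] {U : Opens X.toSheafedSpace} (g : B.obj.Sec U) :
    Hom.on (qcChar hX m).hom U g = (IdealFamily.top U : X.IdealFamily U) ↔
      ∃ f, Hom.on m.hom U f = g :=
  char_eq_top_iff (qc_isCartesian A) (qc_isCartesian B) (injective_of_mono m)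

theorem isPullback_qcChar [Mono m] :
    IsPullback m ((qcOneIsTerminal X).from A) (qcChar hX m) (qcTruth hX) := by
  have w : m ≫ qcChar hX m = (qcOneIsTerminal X).from A ≫ qcTruth hX :=
    ObjectProperty.hom_ext _ (Hom.ext_on fun U a => (qcChar_eq_top_iff hX m _).mpr ⟨a, rfl⟩)
  refine ⟨⟨w⟩, ⟨Limits.PullbackCone.isLimitAux' _ fun s => ?_⟩⟩
  have hs : ∀ U (x : s.pt.obj.Sec U), ∃ a, Hom.on m.hom U a = Hom.on s.fst.hom U x :=
    fun U x => (qcChar_eq_top_iff hX m _).mp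
      (congrArg (fun r : s.pt ⟶ qcOmega hX => Hom.on r.hom U x) s.condition)
  choose l hl using hs
  let L : s.pt ⟶ A := ObjectProperty.homMk (homMk l
    (fun U n x => injective_of_mono m U (by rw [hl, Hom.on_smul, Hom.on_smul, hl]))
    (fun {U V} h x => injective_of_mono m V (by rw [hl, Hom.on_res, Hom.on_res, hl])))
  have hL : L ≫ m = s.fst := ObjectProperty.hom_ext _ (Hom.ext_on hl)
  exact ⟨L, hL, (qcOneIsTerminal X).hom_ext _ _, fun hr _ => (cancel_mono m).mp (hr.trans hL.symm)⟩

theorem qcChar_unique [Mono m] (χ : B ⟶ qcOmega hX)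
    (h : IsPullback m ((qcOneIsTerminal X).from A) χ (qcTruth hX)) : χ = qcChar hX m :=
  ObjectProperty.hom_ext _ (hom_omega_ext fun U g => by
    refine Iff.trans ?_ (qcChar_eq_top_iff hX m g).symm
    constructor
    · exact fun hg => exists_of_isPullback h U g PUnit.unit hg
    · rintro ⟨f, rfl⟩
      exact congrArg (fun r : A ⟶ qcOmega hX => Hom.on r.hom U f) h.w)

/-- The subobject classifier `(Ω^X, t)` of `Qc(X)`. -/
def classifier : Subobject.Classifier (Qc X) :=
  Subobject.Classifier.mkOfTerminalΩ₀ (qcOne X) (qcOneIsTerminal X) (qcOmega hX) (qcTruth hX)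
    (fun m _ => qcChar hX m) (fun m _ => isPullback_qcChar hX m) (fun m _ => qcChar_unique hX m)

end Qc

/-- The sections of `Ω^X` over an affine chart `Spec M` are the ideals of `M`. -/
def omegaChartEquiv {M : Type u} [CommMonoid M] (f : Spec M ⟶ X.toSheafedSpace)
    [SheafedSpace.IsOpenImmersion f] : (X.omega.restrict f).Sec ⊤ ≃ Omega M :=
  (IdealFamily.equivIdeal ((isLocalOpen_im f).mpr (MSpec.isLocalOpen_top M))).trans
    (comapIdealEquiv ((globalSectionsEquiv M).trans (imEquiv f ⊤)))

theorem omegaChartEquiv_smul {M : Type u} [CommMonoid M] (f : Spec M ⟶ X.toSheafedSpace)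
    [SheafedSpace.IsOpenImmersion f] (m : M) (J : (X.omega.restrict f).Sec ⊤) :
    omegaChartEquiv f (globalSectionsEquiv M m • J) = m • omegaChartEquiv f J := by
  refine SetLike.ext (A := SemigroupIdeal M) fun x => ?_
  change ores X.toSheafedSpace le_rfl (imEquiv f ⊤ (globalSectionsEquiv M m)) *
      imEquiv f ⊤ (globalSectionsEquiv M x) ∈ IdealFamily.ideal J _ _ _ ↔
    imEquiv f ⊤ (globalSectionsEquiv M (m * x)) ∈ IdealFamily.ideal J _ _ _
  rw [ores_self, map_mul, map_mul]

/-- Over an affine chart `Spec M`, the classifier is the sheaf associated with the `M`-set of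
ideals, and its truth value is the unit ideal. -/
theorem exists_classifier_restrict_iso (hX : X.IsSNoetherian) (M : Type u) [CommMonoid M]
    (f : Spec M ⟶ X.toSheafedSpace) [SheafedSpace.IsOpenImmersion f] :
    ∃ e : (classifier hX).Ω.obj.restrict f ≅ tilde M (Omega M),
      ∀ (W : (Opens (Spec M))ᵒᵖ) (z : ((classifier hX).Ω₀.obj.restrict f).presheaf.obj W),
        (restrictMap (classifier hX).truth.hom f ≫ e.hom).val.app W z =
          tildeSection M Omega.top W := by
  obtain ⟨e, he⟩ := exists_iso_tilde hX.omega_isCartesian f (omegaChartEquiv f)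
    (omegaChartEquiv_smul f)
  refine ⟨e, fun W z => ?_⟩
  -- both sides are restrictions of global sections of `Spec M`, where `e` is known
  have htop : Hom.on e.hom ⊤ (IdealFamily.top (im f ⊤) : X.IdealFamily (im f ⊤)) =
      tildeSection M Omega.top (op ⊤) := he _
  have hres := Hom.on_res e.hom (le_top : unop W ≤ ⊤)
    (IdealFamily.top (im f ⊤) : X.IdealFamily (im f ⊤))
  rw [htop] at hres
  exact hres

end MonoidScheme

end MonoidGeometry

end

theorem mainTheorem3 (X : MonoidGeometry.MonoidScheme.{u}) (hX : X.IsSNoetherian) :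
    ∃ c : Subobject.Classifier (MonoidGeometry.Qc X),
      ∀ (M : Type u) [CommMonoid M] (f : MonoidGeometry.Spec M ⟶ X.toSheafedSpace)
        [SheafedSpace.IsOpenImmersion f],
        ∃ e : c.Ω.obj.restrict f ≅ MonoidGeometry.tilde M (MonoidGeometry.Omega M),
          ∀ (W : (Opens (MonoidGeometry.Spec M))ᵒᵖ)
            (z : (c.Ω₀.obj.restrict f).presheaf.obj W),
            (MonoidGeometry.OSet.restrictMap c.truth.hom f ≫ e.hom).val.app W z =
              MonoidGeometry.tildeSection M MonoidGeometry.Omega.top W :=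
  ⟨MonoidGeometry.MonoidScheme.classifier hX, fun M _ f _ =>
    MonoidGeometry.MonoidScheme.exists_classifier_restrict_iso hX M f⟩
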